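/- Let $N\ge 1$ and consider an $N\times N$ input-queued switch in discrete time: there is one queue for each pair (input port, output port), $N^2$ queues in total. If $\boldsymbol q(k)\in\mathbb Z_+^{N^2}$ is the vector of queue lengths at the beginning of slot $k$, then $$q_i(k+1)=\max\{q_i(k)+a_i(k)-s_i(k),\,0\},\qquad i=1,\dots,N^2,$$ where the integer arrival vectors $\boldsymbol a(k)\ge 0$ are i.i.d. over $k$, and $\boldsymbol s(k)$ is chosen by MaxWeight, i.e. $\boldsymbol s(k)\in\arg\max_{\boldsymbol x\in\mathcal S}\langle\boldsymbol q(k),\boldsymbol x\rangle$ with ties broken at random, given $\boldsymbol q(k)$ and independently of $\boldsymbol a(k)$. Here $\mathcal S$ is the set of $\boldsymbol x\in\{0,1\}^{N^2}$ with at most one entry equal to $1$ for each input port and for each output port. Let $\boldsymbol\nu$ be a vector with strictly positive entries such that, for each input port and for each output port, the entries of $\boldsymbol\nu$ at that port sum to $1$ (complete saturation). Consider a family of such switches parametrized by $\epsilon\in(0,1)$ with $\mathbb E[\boldsymbol a^{(\epsilon)}(1)]=(1-\epsilon)\boldsymbol\nu$, with $a^{(\epsilon)}_i(1)\le A_{\max}$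 almost surely for all $i$ and a constant $A_{\max}$ that does not depend on $\epsilon$, with arrivals to different queues independent, and with $\lim_{\epsilon\downarrow0}\mathrm{Var}(a_i^{(\epsilon)}(1))=\sigma_{a_i}^2$ for each $i$. Then, for each $\epsilon\in(0,1)$, the Markov chain $\boldsymbol q^{(\epsilon)}(k)$ has a unique steady-state law, to which it converges in distribution from every initial state. If $\overline{\boldsymbol q}^{(\epsilon)}$ has this law, then $\mathbb E\big[\sum_i\overline q_i^{(\epsilon)}\big]<\infty$ and $$\lim_{\epsilon\downarrow 0}\epsilon\,\mathbb E\Big[\sum_{i=1}^{N^2}\overline q^{(\epsilon)}_i\Big]=\Big(1-\frac1{2N}\Big)\sum_{i=1}^{N^2}\sigma_{a_i}^2 .$$ -/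

import Mathlib

open MeasureTheory ProbabilityTheory Filter Topology Set

namespace InputQueued

/-- Nonnegative integer vectors indexed by the `N * N` (input port, output port) pairs: queue lengths,
numbers of arrivals, or potential services. -/
abbrev Vec (N : ℕ) : Type := Fin N × Fin N → ℕ

/-- The feasible schedules: each queue is served at rate `0` or `1`, and at most one queue is active
for each input port (row) and for each output port (column). -/
def feasible (N : ℕ) : Set (Vec N) :=
  {x | (∀ p, x p = 0 ∨ x p = 1) ∧ (∀ i, ∑ j, x (i, j) ≤ 1) ∧ (∀ j, ∑ i, x (i, j) ≤ 1)}

/-- The dot product `⟨q, x⟩`. -/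
def weight {N : ℕ} (q x : Vec N) : ℕ := ∑ p, q p * x p

/-- The MaxWeight schedules for the queue lengths `q`: the argmax of `⟨q, x⟩` over all feasible `x`. -/
def maxWeightSchedules {N : ℕ} (q : Vec N) : Set (Vec N) :=
  {x | x ∈ feasible N ∧ ∀ y ∈ feasible N, weight q y ≤ weight q x}

/-- Queue lengths after one time slot, from queue lengths `q`, potential service `s` and arrivals `a`.
Arrivals precede service and the unused service is `max (s p - q p - a p) 0`, so the new length is
`max (q p + a p - s p) 0`, which is the truncated subtraction of natural numbers. -/
def nextQueue {N : ℕ} (q s a : Vec N) : Vec N := fun p => q p + a p - s p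

/-- The data of an `N × N` input-queued switch operating under MaxWeight: the law of the vector of
arrivals in one time slot, and the random choice of the schedule given the queue lengths, which is
supported on the MaxWeight schedules (the random tie-breaking rule is arbitrary). -/
structure MaxWeightSwitch (N : ℕ) where
  arrival : ProbabilityMeasure (Vec N)
  schedule : Vec N → ProbabilityMeasure (Vec N)
  schedule_maxWeight : ∀ q, ∀ᵐ s ∂(schedule q : Measure (Vec N)), s ∈ maxWeightSchedules q

namespace MaxWeightSwitch

variable {N : ℕ}

/-- One-step transition kernel of the Markov chain of queue lengths: given `q`, the schedule is drawn
from the scheduling rule at `q`, independently of the (i.i.d. over time) arrivals. -/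
noncomputable def transition (S : MaxWeightSwitch N) : Kernel (Vec N) (Vec N) :=
  Kernel.ofFunOfCountable fun q =>
    ((S.schedule q : Measure (Vec N)).prod (S.arrival : Measure (Vec N))).map
      fun sa => nextQueue q sa.1 sa.2

instance (S : MaxWeightSwitch N) : IsMarkovKernel S.transition :=
  ⟨fun _ => Measure.isProbabilityMeasure_map Measurable.of_discrete.aemeasurable⟩

instance (S : MaxWeightSwitch N) (k : ℕ) : IsMarkovKernel (S.transition ^ k) := by
  induction k with
  | zero => rw [pow_zero]; exact inferInstanceAs (IsMarkovKernel Kernel.id)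
  | succ k ih => rw [pow_succ]; exact inferInstanceAs (IsMarkovKernel ((S.transition ^ k) ∘ₖ _))

/-- Law of the vector of queue lengths at the beginning of time slot `k`, started from `q₀`. -/
noncomputable def queueLaw (S : MaxWeightSwitch N) (q₀ : Vec N) (k : ℕ) :
    ProbabilityMeasure (Vec N) :=
  ⟨(S.transition ^ k) q₀, inferInstance⟩

/-- `π` is the law of the steady-state vector of queue lengths: it is stationary, and from every
initial state the chain of queue lengths converges in distribution to `π`. -/
structure IsSteadyState (S : MaxWeightSwitch N) (π : ProbabilityMeasure (Vec N)) : Prop where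
  invariant : Kernel.Invariant S.transition (π : Measure (Vec N))
  tendsto : ∀ q₀, Tendsto (S.queueLaw q₀) atTop (𝓝 π)

end MaxWeightSwitch

/-- The total queue length. -/
def totalQueue {N : ℕ} (q : Vec N) : ℝ := ∑ p, (q p : ℝ)

end InputQueued

/-! For fixed `ε` the chain has finitely supported transitions, the exponential of a small multiple
of the Euclidean norm has geometric drift towards finite sets, and the empty state is accessible
from everywhere and has a self-loop. A weighted-oscillation contraction then gives a steady state
with convergence from every initial state (`FinitelySupported.exists_invariant_tendsto`). The
exponential drift also makes polynomially growing functions integrable, so their drift vanishes in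
steady state.

The limit comes from state space collapse. Let the cone be generated by the row and column
indicators. Since `ν` is at least some `δ > 0`, MaxWeight beats the rate `ν` by at least `δ` times
the distance of the queues to this cone (`dot_add_perp_le_of_maxWeight`). Hence the expected squared
distance stays bounded as `ε` tends to `0` (`exists_perp_bound`).

The quadratic test function is `parallelNormSq`, which is `N ^ 2` times the squared norm of the
projection onto the span of the cone. Apart from the lost service its mean drift at `q` is `-2Nε ∑ q
+ (2N - 1) ∑ Var a + N²ε²`. The lost service pairs with the projection of the new queue vector. It
sits only where the new queue is at most `A`, so this pairing is at most of the order of the lost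
service times one plus the distance to the cone (`abs_dot_parallel_le`). The mean total lost service
is `Nε`, and a weighted AM-GM inequality with parameter `√ε` makes the error `O(√ε)`. Setting the
stationary drift to zero and dividing by `2N` gives the limit.

Schedules need not be perfect matchings: the slack of unmatched ports counts as lost service, placed
on pairs of an unmatched input and an unmatched output, where MaxWeight forces the queue to be empty
(`exists_lost_service`). -/

namespace FiniteRangeChain

/-! ### Ergodic theorem for finitely supported Markov kernels with geometric drift. -/

variable {E : Type*} [MeasurableSpace E]

/-- Every transition law of `κ` is carried by a finite set. -/
def FinitelySupported (κ : Kernel E E) : Prop := ∀ x, ∃ s : Set E, s.Finite ∧ κ x sᶜ = 0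

theorem isMarkovKernel_pow (κ : Kernel E E) [IsMarkovKernel κ] (n : ℕ) :
    IsMarkovKernel (κ ^ n) := by
  induction n with
  | zero => rw [pow_zero]; exact inferInstanceAs (IsMarkovKernel Kernel.id)
  | succ k ih => rw [pow_succ]; exact inferInstanceAs (IsMarkovKernel ((κ ^ k) ∘ₖ _))

/-- Under an invariant measure, one step of the chain does not change expectations. -/
theorem integral_integral_of_invariant {κ : Kernel E E} [IsMarkovKernel κ] {π : Measure E}
    [IsProbabilityMeasure π] (hinv : Kernel.Invariant κ π) {φ : E → ℝ} (hφ : Integrable φ π) :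
    Integrable (fun x => ∫ z, φ z ∂κ x) π ∧ ∫ x, ∫ z, φ z ∂κ x ∂π = ∫ z, φ z ∂π := by
  have e : (κ ∘ₖ Kernel.const Unit π) () = π := by
    rw [Kernel.comp_apply, Kernel.const_apply]; exact hinv
  have hφ' : Integrable φ ((κ ∘ₖ Kernel.const Unit π) ()) := by rwa [e]
  refine ⟨?_, ?_⟩
  · simpa using hφ'.integral_comp
  · have := Kernel.integral_comp hφ'
    rw [e] at this
    simpa using this.symm

/-- The law after `n` steps started from `x`. -/
noncomputable def powLaw (κ : Kernel E E) [IsMarkovKernel κ] (x : E) (n : ℕ) :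
    ProbabilityMeasure E :=
  ⟨(κ ^ n) x, (isMarkovKernel_pow κ n).isProbabilityMeasure x⟩

variable [DiscreteMeasurableSpace E]

theorem integrable_of_finite_support {μ : Measure E} [IsFiniteMeasure μ] {s : Set E}
    (hs : s.Finite) (h0 : μ sᶜ = 0) (φ : E → ℝ) : Integrable φ μ := by
  obtain ⟨C, hC⟩ := (hs.image (fun x => ‖φ x‖)).bddAbove
  refine Integrable.of_bound (Measurable.of_discrete.aestronglyMeasurable) C ?_
  filter_upwards [compl_mem_ae_iff.2 h0] with x hx
  exact hC ⟨x, by simpa using hx, rfl⟩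

theorem FinitelySupported.integrable {κ : Kernel E E} [IsMarkovKernel κ]
    (h : FinitelySupported κ) (φ : E → ℝ) (x : E) : Integrable φ (κ x) := by
  obtain ⟨s, hs, h0⟩ := h x
  exact integrable_of_finite_support hs h0 φ

theorem FinitelySupported.comp {κ η : Kernel E E} (hκ : FinitelySupported κ)
    (hη : FinitelySupported η) : FinitelySupported (κ ∘ₖ η) := by
  intro x
  choose s hs h0 using hκ
  obtain ⟨t, ht, ht0⟩ := hη x
  refine ⟨⋃ y ∈ t, s y, ht.biUnion fun y _ => hs y, ?_⟩
  rw [Kernel.comp_apply' _ _ _ (MeasurableSet.of_discrete), lintegral_eq_zero_iff Measurable.of_discrete]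
  filter_upwards [compl_mem_ae_iff.2 ht0] with y hy
  refine measure_mono_null ?_ (h0 y)
  exact compl_subset_compl.2 (subset_biUnion_of_mem (u := s) (by simpa using hy))

theorem FinitelySupported.pow {κ : Kernel E E} (hκ : FinitelySupported κ) (n : ℕ) :
    FinitelySupported (κ ^ n) := by
  induction n with
  | zero =>
    intro x
    refine ⟨{x}, finite_singleton x, ?_⟩
    rw [pow_zero]
    change Kernel.id x _ = 0
    rw [Kernel.id_apply, Measure.dirac_apply' _ MeasurableSet.of_discrete]
    simp
  | succ k ih => rw [pow_succ]; exact ih.comp hκ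

/-- Chapman–Kolmogorov for integrals. -/
theorem FinitelySupported.integral_pow_add {κ : Kernel E E} [IsMarkovKernel κ]
    (h : FinitelySupported κ) (m n : ℕ) (φ : E → ℝ) (x : E) :
    ∫ z, φ z ∂(κ ^ (m + n)) x = ∫ y, ∫ z, φ z ∂(κ ^ m) y ∂(κ ^ n) x := by
  have := isMarkovKernel_pow κ (m + n)
  have hi : Integrable φ (((κ ^ m) ∘ₖ (κ ^ n)) x) := by
    rw [← Kernel.pow_add]; exact (h.pow _).integrable φ x
  rw [Kernel.pow_add, Kernel.integral_comp hi]

theorem FinitelySupported.integral_pow_le {κ : Kernel E E} [IsMarkovKernel κ]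
    (h : FinitelySupported κ) {V : E → ℝ} {γ K : ℝ} (hγ0 : 0 ≤ γ) (hγ1 : γ < 1)
    (hV : ∀ x, ∫ y, V y ∂κ x ≤ γ * V x + K) (n : ℕ) (x : E) :
    ∫ y, V y ∂(κ ^ n) x ≤ γ ^ n * V x + K * (1 - γ ^ n) / (1 - γ) := by
  have hγ : 1 - γ ≠ 0 := by linarith
  induction n with
  | zero =>
    rw [pow_zero]
    change ∫ y, V y ∂(Kernel.id x) ≤ _
    rw [Kernel.id_apply, integral_dirac]
    simp
  | succ n ih =>
    have := isMarkovKernel_pow κ n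
    rw [add_comm n 1, h.integral_pow_add]
    simp only [pow_one]
    have hi := fun φ => (h.pow n).integrable φ x
    calc ∫ y, ∫ z, V z ∂κ y ∂(κ ^ n) x ≤ ∫ y, (γ * V y + K) ∂(κ ^ n) x :=
          integral_mono (hi _) (hi _) fun y => hV y
      _ = γ * ∫ y, V y ∂(κ ^ n) x + K := by
          rw [integral_add (hi _) (hi _), integral_const_mul]; simp
      _ ≤ γ * (γ ^ n * V x + K * (1 - γ ^ n) / (1 - γ)) + K := by gcongr
      _ = _ := by field_simp; ring

/-- Weighted contraction of the oscillation: a drift condition together with a common atom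
reached from sublevel sets. -/
theorem exists_contraction {P : Kernel E E} [IsMarkovKernel P] (h : FinitelySupported P)
    {V : E → ℝ} (hV0 : ∀ x, 0 ≤ V x) {γ K : ℝ} (hγ0 : 0 ≤ γ) (hγ1 : γ < 1) (hK : 0 < K)
    (hV : ∀ x, ∫ y, V y ∂P x ≤ γ * V x + K) (e : E) {α : ℝ} (hα : 0 < α)
    (hmin : ∀ x, V x ≤ 4 * K / (1 - γ) → α ≤ (P x).real {e}) :
    ∃ β > 0, ∃ ρ, 0 ≤ ρ ∧ ρ < 1 ∧ ∀ (φ : E → ℝ) (C : ℝ), 0 ≤ C →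
      (∀ x y, |φ x - φ y| ≤ C * (2 + β * V x + β * V y)) →
      ∀ x y, |∫ z, φ z ∂P x - ∫ z, φ z ∂P y| ≤ ρ * C * (2 + β * V x + β * V y) := by
  set R := 4 * K / (1 - γ) with hR
  have hRpos : 0 < R := div_pos (by linarith) (by linarith)
  have hRγ : (1 - γ) * R = 4 * K := by rw [hR]; field_simp [show (1 - γ) ≠ 0 by linarith]
  -- With this weight the additive drift costs `2βK = α²`, half of the gain `2α²` from meeting at
  -- the atom.
  set β := α ^ 2 / (2 * K) with hβ
  have hβpos : 0 < β := by positivity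
  have hβK : 2 * (β * K) = α ^ 2 := by rw [hβ]; field_simp
  -- `t` is the contraction gap: the first bound serves small `V x + V y`, the last serves large
  -- values, `t ≤ 1 - γ` serves both, and `t ≤ 1` keeps `ρ = 1 - t` nonnegative.
  obtain ⟨t, ht0, ht1, ht2, ht3, ht4⟩ : ∃ t : ℝ, 0 < t ∧ t ≤ α ^ 2 / 2 ∧ t ≤ 1 - γ ∧
      t ≤ 1 ∧ t ≤ 2 * K * β / (2 + β * R) := by
    refine ⟨min (α ^ 2 / 2) (min (1 - γ) (min 1 (2 * K * β / (2 + β * R)))), ?_, ?_, ?_, ?_, ?_⟩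
    · have : 0 < 1 - γ := by linarith
      positivity
    · exact min_le_left _ _
    · exact (min_le_right _ _).trans (min_le_left _ _)
    · exact (min_le_right _ _).trans ((min_le_right _ _).trans (min_le_left _ _))
    · exact (min_le_right _ _).trans ((min_le_right _ _).trans (min_le_right _ _))
  refine ⟨β, hβpos, 1 - t, by linarith, by linarith, fun φ C hC hφ x y => ?_⟩
  classical
  set I : E → ℝ := Set.indicator {e} 1 with hI
  have hIint : ∀ x, ∫ u, I u ∂P x = (P x).real {e} := fun x =>
    integral_indicator_one MeasurableSet.of_discrete
  have hi := fun φ x => h.integrable φ x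
  -- Under the independent coupling the difference vanishes when both copies sit at `e`, which saves
  -- at least `2C` there. Integrating in `v` and then in `u` gives `h2`.
  have hpt : ∀ u v, |φ u - φ v| ≤ C * (2 + β * V u + β * V v) - 2 * C * (I u * I v) := by
    intro u v
    by_cases hu : u = e
    · by_cases hv : v = e
      · subst hu; subst hv
        simp only [hI, sub_self, abs_zero, mem_singleton_iff, indicator_of_mem, Pi.one_apply]
        have := mul_nonneg hC (mul_nonneg hβpos.le (hV0 v))
        linarith
      · simpa [hI, hv] using hφ u v
    · simpa [hI, hu] using hφ u v
  have h1 : ∀ u, |φ u - ∫ z, φ z ∂P y| ≤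
      C * (2 + β * V u + β * ∫ z, V z ∂P y) - 2 * C * (I u * (P y).real {e}) := by
    intro u
    have e1 : φ u - ∫ z, φ z ∂P y = ∫ z, (φ u - φ z) ∂P y := by
      rw [integral_sub (hi _ _) (hi _ _)]; simp
    rw [e1]
    refine (abs_integral_le_integral_abs).trans ((integral_mono (hi _ _) (hi _ _) (hpt u)).trans ?_)
    apply le_of_eq
    rw [integral_sub (hi _ _) (hi _ _), integral_const_mul, integral_const_mul, integral_const_mul,
      integral_add (hi _ _) (hi _ _), integral_const_mul, hIint]
    simp
  have h2 : |∫ z, φ z ∂P x - ∫ z, φ z ∂P y| ≤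
      C * (2 + β * ∫ z, V z ∂P x + β * ∫ z, V z ∂P y)
        - 2 * C * ((P x).real {e} * (P y).real {e}) := by
    have e1 : ∫ z, φ z ∂P x - ∫ z, φ z ∂P y = ∫ u, (φ u - ∫ z, φ z ∂P y) ∂P x := by
      rw [integral_sub (hi _ _) (hi _ _)]; simp
    rw [e1]
    refine (abs_integral_le_integral_abs).trans ((integral_mono (hi _ _) (hi _ _) h1).trans ?_)
    apply le_of_eq
    rw [integral_sub (hi _ _) (hi _ _), integral_const_mul, integral_const_mul, integral_mul_const,
      integral_add (hi _ _) (hi _ _), integral_add (hi _ _) (hi _ _), integral_const_mul, hIint]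
    simp
  refine h2.trans ?_
  have hx := hV x
  have hy := hV y
  have hS : 0 ≤ V x + V y := add_nonneg (hV0 x) (hV0 y)
  have h3 : C * (2 + β * ∫ z, V z ∂P x + β * ∫ z, V z ∂P y)
        - 2 * C * ((P x).real {e} * (P y).real {e}) ≤
      C * (2 + β * γ * (V x + V y) + 2 * (β * K) - 2 * ((P x).real {e} * (P y).real {e})) := by
    have : β * ∫ z, V z ∂P x + β * ∫ z, V z ∂P y ≤ β * γ * (V x + V y) + 2 * (β * K) := by
      nlinarith
    nlinarith [mul_le_mul_of_nonneg_left this hC]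
  refine h3.trans ?_
  rw [mul_comm (1 - t) C, mul_assoc C]
  refine mul_le_mul_of_nonneg_left ?_ hC
  have hpx : 0 ≤ (P x).real {e} := measureReal_nonneg
  have hpy : 0 ≤ (P y).real {e} := measureReal_nonneg
  have hβS : 0 ≤ β * (V x + V y) := mul_nonneg hβpos.le hS
  -- Below `R` both points satisfy the minorization, with net gain `α² ≥ 2t`. Above `R` the drift
  -- alone gains `β(1 - γ)R = 4Kβ`, twice the additive cost `2Kβ`.
  by_cases hle : V x + V y ≤ R
  · have hx' := hmin x (by linarith [hV0 y])
    have hy' := hmin y (by linarith [hV0 x])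
    have : α ^ 2 ≤ (P x).real {e} * (P y).real {e} := by
      rw [sq]; exact mul_le_mul hx' hy' hα.le hpx
    nlinarith [mul_le_mul_of_nonneg_right ht2 hβS]
  · push Not at hle
    have h5 : t * (2 + β * R) ≤ 2 * K * β := by
      rwa [le_div_iff₀ (by positivity)] at ht4
    have h6 : (1 - t - γ) * (β * R) ≤ (1 - t - γ) * (β * (V x + V y)) := by
      refine mul_le_mul_of_nonneg_left ?_ (by linarith)
      exact mul_le_mul_of_nonneg_left hle.le hβpos.le
    have h7 : 0 ≤ (P x).real {e} * (P y).real {e} := mul_nonneg hpx hpy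
    have h8 : β * ((1 - γ) * R) = β * (4 * K) := by rw [hRγ]
    nlinarith

theorem pow_add_one_apply_ne_zero {κ : Kernel E E} {e x : E} (he : κ e {e} ≠ 0) {n : ℕ}
    (hn : (κ ^ n) x {e} ≠ 0) : (κ ^ (n + 1)) x {e} ≠ 0 := by
  rw [Kernel.pow_succ_apply_eq_lintegral κ n x MeasurableSet.of_discrete]
  intro h0
  have := setLIntegral_le_lintegral {e} (μ := (κ ^ n) x) (fun b => κ b {e})
  rw [lintegral_singleton, h0] at this
  simp_all

/-- From a finite set of states, an atom that is accessible and aperiodic is charged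
simultaneously after some common number of steps. -/
theorem exists_common_minorization {κ : Kernel E E} {e : E} [IsMarkovKernel κ] (he : κ e {e} ≠ 0)
    (hacc : ∀ x, ∃ n, (κ ^ n) x {e} ≠ 0) {s : Set E} (hs : s.Finite) :
    ∃ m, 1 ≤ m ∧ ∃ α > 0, ∀ x ∈ s, α ≤ ((κ ^ m) x).real {e} := by
  choose n hn using hacc
  have hmono : ∀ x k, (κ ^ (n x + k)) x {e} ≠ 0 := by
    intro x k
    induction k with
    | zero => exact hn x
    | succ k ih => exact pow_add_one_apply_ne_zero he ih
  obtain ⟨m, hm⟩ := (hs.image n).bddAbove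
  have hpos : ∀ x ∈ s, 0 < ((κ ^ (m + 1)) x).real {e} := by
    intro x hx
    have := isMarkovKernel_pow κ (m + 1)
    have hle : n x ≤ m + 1 := (hm ⟨x, hx, rfl⟩).trans (Nat.le_succ m)
    obtain ⟨k, hk⟩ := Nat.exists_eq_add_of_le hle
    have := hmono x k
    rw [← hk] at this
    exact ENNReal.toReal_pos this (measure_ne_top _ _)
  refine ⟨m + 1, by omega, ?_⟩
  rcases s.eq_empty_or_nonempty with rfl | hne
  · exact ⟨1, one_pos, by simp⟩
  · obtain ⟨x, hx, hmin⟩ := hs.exists_minimalFor (fun x => ((κ ^ (m + 1)) x).real {e}) s hne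
    refine ⟨_, hpos x hx, fun y hy => ?_⟩
    by_contra hlt
    exact hlt (hmin hy (not_le.1 hlt).le)

/-- Asymptotic coupling: the `n`-step expectations of a bounded function forget the initial
state. -/
theorem FinitelySupported.tendsto_integral_pow_sub {κ : Kernel E E} [IsMarkovKernel κ]
    (h : FinitelySupported κ) {V : E → ℝ} (hV0 : ∀ x, 0 ≤ V x)
    (hfin : ∀ R, {x | V x ≤ R}.Finite) {γ K : ℝ} (hγ0 : 0 ≤ γ) (hγ1 : γ < 1) (hK : 0 < K)
    (hV : ∀ x, ∫ y, V y ∂κ x ≤ γ * V x + K) {e : E} (he : κ e {e} ≠ 0)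
    (hacc : ∀ x, ∃ n, (κ ^ n) x {e} ≠ 0) {φ : E → ℝ} (hφ : ∀ x, |φ x| ≤ 1) (x y : E) :
    Tendsto (fun n => ∫ z, φ z ∂(κ ^ n) x - ∫ z, φ z ∂(κ ^ n) y) atTop (𝓝 0) := by
  have hg : 0 < 1 - γ := by linarith
  -- This constant bounds the drift of every positive power of `κ`, so the sublevel set to be
  -- minorized is fixed before the number of steps `m` is known.
  set K' := K / (1 - γ) with hK'
  have hK'pos : 0 < K' := by positivity
  obtain ⟨m, hm1, α, hα, hmin⟩ := exists_common_minorization he hacc (hfin (4 * K' / (1 - γ)))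
  have := fun n => isMarkovKernel_pow κ n
  have hdrift : ∀ x, ∫ y, V y ∂(κ ^ m) x ≤ γ * V x + K' := by
    intro x
    refine (h.integral_pow_le hγ0 hγ1 hV m x).trans ?_
    have h1 : γ ^ m ≤ γ := pow_le_of_le_one hγ0 hγ1.le (by omega)
    have h2 : K * (1 - γ ^ m) / (1 - γ) ≤ K' := by
      rw [hK']; gcongr; nlinarith [pow_nonneg hγ0 m]
    nlinarith [mul_le_mul_of_nonneg_right h1 (hV0 x)]
  obtain ⟨β, hβ, ρ, hρ0, hρ1, hcon⟩ :=
    exists_contraction (h.pow m) hV0 hγ0 hγ1 hK'pos hdrift e hα (fun x hx => hmin x hx)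
  have hbd : ∀ n x, |∫ z, φ z ∂(κ ^ n) x| ≤ 1 := by
    intro n x
    have := norm_integral_le_of_norm_le_const (μ := (κ ^ n) x) (f := φ) (C := 1)
      (Eventually.of_forall fun z => by simpa using hφ z)
    simpa using this
  have key : ∀ k r x y, |∫ z, φ z ∂(κ ^ (k * m + r)) x - ∫ z, φ z ∂(κ ^ (k * m + r)) y| ≤
      ρ ^ k * (2 + β * V x + β * V y) := by
    intro k r
    induction k with
    | zero =>
      intro x y
      have h1 := abs_le.1 (hbd (0 * m + r) x)
      have h2 := abs_le.1 (hbd (0 * m + r) y)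
      have h3 := mul_nonneg hβ.le (hV0 x)
      have h4 := mul_nonneg hβ.le (hV0 y)
      rw [abs_le]
      constructor <;> linarith
    | succ k ih =>
      intro x y
      have := hcon _ (ρ ^ k) (pow_nonneg hρ0 k) ih x y
      rw [show (k + 1) * m + r = (k * m + r) + m by ring, h.integral_pow_add, h.integral_pow_add,
        pow_succ']
      exact this
  have hlim : Tendsto (fun n : ℕ => ρ ^ (n / m) * (2 + β * V x + β * V y)) atTop (𝓝 0) := by
    have := ((tendsto_pow_atTop_nhds_zero_of_lt_one hρ0 hρ1).comp
      (Nat.tendsto_div_const_atTop (by omega : m ≠ 0))).mul_const (2 + β * V x + β * V y)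
    simpa using this
  refine squeeze_zero_norm (fun n => ?_) hlim
  have := key (n / m) (n % m) x y
  rw [Nat.div_add_mod'] at this
  exact this

/-- **Ergodic theorem.** A finitely supported Markov kernel with a geometric drift towards finite
sets and an accessible aperiodic state has an invariant probability measure to which it converges
from every state. -/
theorem FinitelySupported.exists_invariant_tendsto [TopologicalSpace E] [DiscreteTopology E]
    [OpensMeasurableSpace E] {κ : Kernel E E} [IsMarkovKernel κ]
    (h : FinitelySupported κ) {V : E → ℝ} (hV0 : ∀ x, 0 ≤ V x)
    (hfin : ∀ R, {x | V x ≤ R}.Finite) {γ K : ℝ} (hγ0 : 0 ≤ γ) (hγ1 : γ < 1) (hK : 0 < K)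
    (hV : ∀ x, ∫ y, V y ∂κ x ≤ γ * V x + K) {e : E} (he : κ e {e} ≠ 0)
    (hacc : ∀ x, ∃ n, (κ ^ n) x {e} ≠ 0) :
    ∃ π : ProbabilityMeasure E, Kernel.Invariant κ (π : Measure E) ∧
      ∀ x, Tendsto (powLaw κ x) atTop (𝓝 π) := by
  have hM := fun n => isMarkovKernel_pow κ n
  have : BorelSpace E := ⟨by
    rw [borel_eq_top_of_discrete]; exact eq_top_iff.2 fun s _ => MeasurableSet.of_discrete⟩
  have hg : 0 < 1 - γ := by linarith
  have hVn : ∀ n, ∫ y, V y ∂(κ ^ n) e ≤ V e + K / (1 - γ) := by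
    intro n
    refine (h.integral_pow_le hγ0 hγ1 hV n e).trans ?_
    have h1 : γ ^ n ≤ 1 := pow_le_one₀ hγ0 hγ1.le
    have h2 : K * (1 - γ ^ n) / (1 - γ) ≤ K / (1 - γ) := by
      gcongr; nlinarith [pow_nonneg hγ0 n]
    nlinarith [mul_le_mul_of_nonneg_right h1 (hV0 e)]
  set c := V e + K / (1 - γ) with hc
  have hcpos : 0 < c := add_pos_of_nonneg_of_pos (hV0 e) (by positivity)
  -- Markov's inequality for `V` gives tightness, since sublevel sets of `V` are finite and hence
  -- compact.
  have htight : IsTightMeasureSet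
      {((ν : ProbabilityMeasure E) : Measure E) | ν ∈ range (powLaw κ e)} := by
    rw [isTightMeasureSet_iff_exists_isCompact_measure_compl_le]
    intro η hη
    by_cases hηt : η = ⊤
    · exact ⟨∅, isCompact_empty, by simp [hηt]⟩
    have hηr : 0 < η.toReal := ENNReal.toReal_pos hη.ne' hηt
    refine ⟨{x | V x ≤ c / η.toReal}, (hfin _).isCompact, ?_⟩
    rintro _ ⟨_, ⟨n, rfl⟩, rfl⟩
    have hmk := mul_meas_ge_le_integral_of_nonneg (μ := (κ ^ n) e) (f := V)
      (Eventually.of_forall hV0) ((h.pow n).integrable V e) (c / η.toReal)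
    have h2 : ((κ ^ n) e).real {x | c / η.toReal ≤ V x} ≤ η.toReal := by
      have h3 := hmk.trans (hVn n)
      rw [div_mul_eq_mul_div, div_le_iff₀ hηr] at h3
      exact le_of_mul_le_mul_left h3 hcpos
    have h4 : ((κ ^ n) e).real {x | V x ≤ c / η.toReal}ᶜ ≤ η.toReal := by
      refine (measureReal_mono ?_ (measure_ne_top _ _)).trans h2
      intro z hz
      simp only [mem_compl_iff, mem_ofPred_eq, not_le] at hz ⊢
      exact hz.le
    exact (ENNReal.toReal_le_toReal (measure_ne_top _ _) hηt).1 h4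
  have hcomp := isCompact_closure_of_isTightMeasureSet htight
  -- The candidate is a limit along a nonprincipal ultrafilter. Forgetting of the initial state will
  -- show it invariant and upgrade this to full convergence.
  obtain ⟨π, -, hπ⟩ := isCompact_iff_ultrafilter_le_nhds.1 hcomp
    ((hyperfilter ℕ).map (powLaw κ e)) (by
      rw [le_principal_iff]
      exact Filter.mem_map.2 (univ_mem' fun n => subset_closure ⟨n, rfl⟩))
  have hπ' : Tendsto (powLaw κ e) (hyperfilter ℕ : Filter ℕ) (𝓝 π) := hπ
  have hat : (hyperfilter ℕ : Filter ℕ) ≤ atTop := Nat.hyperfilter_le_atTop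
  -- bounded functions
  have hlim : ∀ φ : E → ℝ, (∀ x, |φ x| ≤ 1) →
      Tendsto (fun n => ∫ z, φ z ∂(κ ^ n) e) (hyperfilter ℕ : Filter ℕ)
        (𝓝 (∫ z, φ z ∂(π : Measure E))) := by
    intro φ hφ
    exact (ProbabilityMeasure.tendsto_iff_forall_integral_tendsto.1 hπ')
      (BoundedContinuousFunction.ofNormedAddCommGroupDiscrete φ 1 hφ)
  have hforget : ∀ φ : E → ℝ, (∀ x, |φ x| ≤ 1) → ∀ x y,
      Tendsto (fun n => ∫ z, φ z ∂(κ ^ n) x - ∫ z, φ z ∂(κ ^ n) y) atTop (𝓝 0) :=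
    fun φ hφ => h.tendsto_integral_pow_sub hV0 hfin hγ0 hγ1 hK hV he hacc hφ
  have hstep : ∀ (φ : E → ℝ), (∀ x, |φ x| ≤ 1) → ∀ {η : Kernel E E} [IsMarkovKernel η] (x : E),
      |∫ z, φ z ∂η x| ≤ 1 := by
    intro φ hφ η _ x
    have := norm_integral_le_of_norm_le_const (μ := η x) (f := φ) (C := 1)
      (Eventually.of_forall fun z => by simpa using hφ z)
    simpa using this
  have hbdd_int : ∀ (φ : E → ℝ), (∀ x, |φ x| ≤ 1) → Integrable φ (π : Measure E) := by
    intro φ hφ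
    exact Integrable.of_bound Measurable.of_discrete.aestronglyMeasurable 1
      (Eventually.of_forall hφ)
  have hinvφ : ∀ φ : E → ℝ, (∀ x, |φ x| ≤ 1) →
      ∫ x, ∫ z, φ z ∂κ x ∂(π : Measure E) = ∫ z, φ z ∂(π : Measure E) := by
    intro φ hφ
    have h1 := hlim (fun x => ∫ z, φ z ∂κ x) (fun x => hstep φ hφ x)
    have h2 := hlim φ hφ
    have h3 : Tendsto (fun n => ∫ y, ∫ z, φ z ∂κ y ∂(κ ^ n) e - ∫ z, φ z ∂(κ ^ n) e)
        atTop (𝓝 0) := by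
      -- An extra step at the end equals an extra step at the start, so the change averages
      -- differences between two initial states, and these tend to zero.
      have e1 : ∀ n, ∫ y, ∫ z, φ z ∂κ y ∂(κ ^ n) e - ∫ z, φ z ∂(κ ^ n) e =
          ∫ y, (∫ z, φ z ∂(κ ^ n) y - ∫ z, φ z ∂(κ ^ n) e) ∂κ e := by
        intro n
        have e2 := h.integral_pow_add 1 n φ e
        have e3 := h.integral_pow_add n 1 φ e
        rw [pow_one] at e2 e3
        rw [add_comm] at e2
        rw [integral_sub (h.integrable _ _) (h.integrable _ _), ← e3, ← e2]
        simp
      simp_rw [e1]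
      have := tendsto_integral_of_dominated_convergence (μ := κ e) (f := fun _ => (0 : ℝ))
        (F := fun n y => ∫ z, φ z ∂(κ ^ n) y - ∫ z, φ z ∂(κ ^ n) e) (fun _ => (2 : ℝ))
        (fun n => Measurable.of_discrete.aestronglyMeasurable) (integrable_const _)
        (fun n => Eventually.of_forall fun y => by
          have a1 := abs_le.1 (hstep φ hφ (η := κ ^ n) y)
          have a2 := abs_le.1 (hstep φ hφ (η := κ ^ n) e)
          rw [Real.norm_eq_abs, abs_le]
          constructor <;> linarith)
        (Eventually.of_forall fun y => hforget φ hφ y e)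
      simpa using this
    have h4 := tendsto_nhds_unique (h1.sub h2) (h3.mono_left hat)
    linarith
  refine ⟨π, ?_, fun x => ?_⟩
  · refine Measure.ext fun s hs => ?_
    have h1 := hinvφ (s.indicator 1) (fun x => by
      by_cases hx : x ∈ s <;> simp [hx])
    simp_rw [integral_indicator_one hs] at h1
    rw [Measure.bind_apply hs (Kernel.aemeasurable _)]
    have h2 : ∀ x, κ x s = ENNReal.ofReal ((κ x).real s) := fun x => by
      rw [ofReal_measureReal]
    simp_rw [h2]
    rw [← ofReal_integral_eq_lintegral_ofReal
      (hbdd_int (fun x => (κ x).real s) (fun x => by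
        rw [abs_of_nonneg measureReal_nonneg]; exact measureReal_le_one))
      (Eventually.of_forall fun x => measureReal_nonneg), h1, ofReal_measureReal]
  · rw [ProbabilityMeasure.tendsto_iff_forall_integral_tendsto]
    intro f
    obtain ⟨C, hCpos, hC⟩ : ∃ C : ℝ, 0 < C ∧ ∀ x, |f x| ≤ C :=
      ⟨‖f‖ + 1, by positivity, fun x => (f.norm_coe_le_norm x).trans (by linarith)⟩
    set φ : E → ℝ := fun x => C⁻¹ * f x with hφdef
    have hφ : ∀ x, |φ x| ≤ 1 := by
      intro x
      rw [hφdef, abs_mul, abs_of_pos (inv_pos.2 hCpos), inv_mul_le_one₀ hCpos]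
      exact hC x
    have hiter : ∀ n, ∫ y, ∫ z, φ z ∂(κ ^ n) y ∂(π : Measure E) = ∫ z, φ z ∂(π : Measure E) := by
      intro n
      induction n with
      | zero =>
        refine integral_congr_ae (Eventually.of_forall fun y => ?_)
        change ∫ z, φ z ∂(Kernel.id y) = φ y
        rw [Kernel.id_apply, integral_dirac]
      | succ n ih =>
        rw [← ih, ← hinvφ _ (fun y => hstep φ hφ (η := κ ^ n) y)]
        refine integral_congr_ae (Eventually.of_forall fun y => ?_)
        have := h.integral_pow_add n 1 φ y
        rw [pow_one] at this
        exact this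
    have h1 : Tendsto (fun n => ∫ z, φ z ∂(κ ^ n) x - ∫ z, φ z ∂(π : Measure E))
        atTop (𝓝 0) := by
      have e1 : ∀ n, ∫ z, φ z ∂(κ ^ n) x - ∫ z, φ z ∂(π : Measure E) =
          ∫ y, (∫ z, φ z ∂(κ ^ n) x - ∫ z, φ z ∂(κ ^ n) y) ∂(π : Measure E) := by
        intro n
        rw [integral_sub (integrable_const _) (hbdd_int _ (fun y => hstep φ hφ (η := κ ^ n) y)),
          hiter]
        simp
      simp_rw [e1]
      have := tendsto_integral_of_dominated_convergence (μ := (π : Measure E))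
        (f := fun _ => (0 : ℝ))
        (F := fun n y => ∫ z, φ z ∂(κ ^ n) x - ∫ z, φ z ∂(κ ^ n) y) (fun _ => (2 : ℝ))
        (fun n => Measurable.of_discrete.aestronglyMeasurable) (integrable_const _)
        (fun n => Eventually.of_forall fun y => by
          have a1 := abs_le.1 (hstep φ hφ (η := κ ^ n) x)
          have a2 := abs_le.1 (hstep φ hφ (η := κ ^ n) y)
          rw [Real.norm_eq_abs, abs_le]
          constructor <;> linarith)
        (Eventually.of_forall fun y => hforget φ hφ x y)
      simpa using this
    have h2 := (h1.const_mul C).add_const (∫ z, f z ∂(π : Measure E))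
    have e2 : ∀ ν : Measure E, C * ∫ z, φ z ∂ν = ∫ z, f z ∂ν := by
      intro ν
      rw [hφdef, integral_const_mul, ← mul_assoc, mul_inv_cancel₀ hCpos.ne', one_mul]
    simp_rw [mul_sub, e2] at h2
    simpa [powLaw] using h2

/-- A nonnegative function whose expectations stay bounded along a sequence of laws is integrable
under every weak limit. -/
theorem integrable_of_tendsto_of_integral_le [TopologicalSpace E] [DiscreteTopology E]
    [OpensMeasurableSpace E] {μ : ℕ → ProbabilityMeasure E} {π : ProbabilityMeasure E}
    (hμ : Tendsto μ atTop (𝓝 π)) {V : E → ℝ} (hV0 : ∀ x, 0 ≤ V x)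
    (hi : ∀ n, Integrable V (μ n : Measure E)) {c : ℝ}
    (hc : ∀ n, ∫ x, V x ∂(μ n : Measure E) ≤ c) : Integrable V (π : Measure E) := by
  have hm : Measurable V := Measurable.of_discrete
  -- Truncations are bounded, so weak convergence applies to them; monotone convergence then removes
  -- the truncation.
  have htr : ∀ k : ℕ, ∫⁻ x, ENNReal.ofReal (min (V x) k) ∂(π : Measure E) ≤ ENNReal.ofReal c := by
    intro k
    have hb : ∀ x, ‖min (V x) (k : ℝ)‖ ≤ k := fun x => by
      rw [Real.norm_eq_abs, abs_of_nonneg (le_min (hV0 x) (Nat.cast_nonneg k))]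
      exact min_le_right _ _
    have hin : ∀ ν : ProbabilityMeasure E, Integrable (fun x => min (V x) (k : ℝ)) (ν : Measure E) :=
      fun ν => Integrable.of_bound (Measurable.of_discrete.aestronglyMeasurable) k
        (Eventually.of_forall hb)
    have h1 := (ProbabilityMeasure.tendsto_iff_forall_integral_tendsto.1 hμ)
      (BoundedContinuousFunction.ofNormedAddCommGroupDiscrete (fun x => min (V x) (k : ℝ)) k hb)
    have h2 : ∫ x, min (V x) (k : ℝ) ∂(π : Measure E) ≤ c :=
      le_of_tendsto' h1 fun n =>
        (integral_mono (hin _) (hi n) fun x => min_le_left _ _).trans (hc n)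
    rw [← ofReal_integral_eq_lintegral_ofReal (hin _)
      (Eventually.of_forall fun x => le_min (hV0 x) (Nat.cast_nonneg k))]
    exact ENNReal.ofReal_le_ofReal h2
  refine ⟨hm.aestronglyMeasurable, ?_⟩
  rw [hasFiniteIntegral_iff_ofReal (Eventually.of_forall hV0)]
  have hsup : ∀ x, ENNReal.ofReal (V x) = ⨆ k : ℕ, ENNReal.ofReal (min (V x) k) := by
    intro x
    refine le_antisymm ?_ (iSup_le fun k => ENNReal.ofReal_le_ofReal (min_le_left _ _))
    obtain ⟨k, hk⟩ := exists_nat_ge (V x)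
    refine le_iSup_of_le k ?_
    rw [min_eq_left hk]
  simp_rw [hsup]
  rw [lintegral_iSup (fun k => Measurable.of_discrete)]
  · exact (iSup_le htr).trans_lt ENNReal.ofReal_lt_top
  · intro k l hkl x
    exact ENNReal.ofReal_le_ofReal (min_le_min_left _ (by exact_mod_cast hkl))

end FiniteRangeChain

/-! ### The switch as a finitely supported chain, and accessibility of the empty state. -/

namespace InputQueued

open FiniteRangeChain

variable {N : ℕ}

theorem feasible_subset_Icc : feasible N ⊆ Icc 0 1 := fun x hx =>
  ⟨fun p => Nat.zero_le _, fun p => by rcases hx.1 p with h | h <;> simp [h]⟩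

theorem maxWeightSchedules_finite (q : Vec N) : (maxWeightSchedules q).Finite :=
  (finite_Icc (0 : Vec N) 1).subset fun _ hx => feasible_subset_Icc hx.1

theorem bounded_arrivals_finite (A : ℕ) : {a : Vec N | ∀ p, a p ≤ A}.Finite :=
  (finite_Icc (0 : Vec N) fun _ => A).subset fun _ ha => ⟨fun _ => Nat.zero_le _, ha⟩

/-- A single nonempty queue can always be served. -/
theorem single_mem_feasible (p : Fin N × Fin N) : (Pi.single p 1 : Vec N) ∈ feasible N := by
  classical
  refine ⟨fun p' => ?_, fun i => ?_, fun j => ?_⟩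
  · by_cases h : p' = p
    · subst h; simp
    · simp [h]
  · obtain ⟨i', j'⟩ := p
    by_cases h : i = i' <;> simp [Pi.single_apply, h, Prod.ext_iff]
  · obtain ⟨i', j'⟩ := p
    by_cases h : j = j' <;> simp [Pi.single_apply, h, Prod.ext_iff]

/-- Without arrivals, MaxWeight strictly decreases a nonzero total queue length. -/
theorem sum_nextQueue_zero_lt {q s : Vec N} (hq : q ≠ 0) (hs : s ∈ maxWeightSchedules q) :
    ∑ p, nextQueue q s 0 p < ∑ p, q p := by
  classical
  obtain ⟨p, hp⟩ := Function.ne_iff.1 hq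
  have h1 := hs.2 _ (single_mem_feasible p)
  have h2 : weight q (Pi.single p 1) = q p := by
    simp [weight, Pi.single_apply]
  rw [h2] at h1
  have h3 : weight q s ≠ 0 := by
    have : q p ≠ 0 := hp
    omega
  obtain ⟨p', -, hp'⟩ := Finset.exists_ne_zero_of_sum_ne_zero h3
  refine Finset.sum_lt_sum (fun r _ => ?_) ⟨p', Finset.mem_univ _, ?_⟩
  · simp [nextQueue]
  · have h4 : q p' ≠ 0 := left_ne_zero_of_mul hp'
    have h5 : s p' ≠ 0 := right_ne_zero_of_mul hp'
    simp only [nextQueue, Pi.zero_apply, add_zero]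
    omega

namespace MaxWeightSwitch

variable (S : MaxWeightSwitch N)

theorem transition_apply (q : Vec N) :
    S.transition q = ((S.schedule q : Measure (Vec N)).prod (S.arrival : Measure (Vec N))).map
      fun sa => nextQueue q sa.1 sa.2 := rfl

variable {S} {A : ℕ}

theorem ae_prod (h_bdd : ∀ᵐ a ∂(S.arrival : Measure (Vec N)), ∀ p, a p ≤ A) (q : Vec N) :
    ∀ᵐ sa ∂((S.schedule q : Measure (Vec N)).prod (S.arrival : Measure (Vec N))),
      sa.1 ∈ maxWeightSchedules q ∧ ∀ p, sa.2 p ≤ A := by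
  filter_upwards [Measure.quasiMeasurePreserving_fst.ae (S.schedule_maxWeight q),
    Measure.quasiMeasurePreserving_snd.ae h_bdd] with sa h1 h2
  exact ⟨h1, h2⟩

theorem integrable_prod (h_bdd : ∀ᵐ a ∂(S.arrival : Measure (Vec N)), ∀ p, a p ≤ A) (q : Vec N)
    (φ : Vec N × Vec N → ℝ) :
    Integrable φ ((S.schedule q : Measure (Vec N)).prod (S.arrival : Measure (Vec N))) :=
  integrable_of_finite_support
    (s := maxWeightSchedules q ×ˢ {a : Vec N | ∀ p, a p ≤ A})
    ((maxWeightSchedules_finite q).prod (bounded_arrivals_finite A))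
    (ae_prod h_bdd q) φ

theorem integrable_arrival (h_bdd : ∀ᵐ a ∂(S.arrival : Measure (Vec N)), ∀ p, a p ≤ A)
    (φ : Vec N → ℝ) : Integrable φ (S.arrival : Measure (Vec N)) :=
  integrable_of_finite_support (s := {a : Vec N | ∀ p, a p ≤ A}) (bounded_arrivals_finite A) h_bdd φ

theorem finitelySupported (h_bdd : ∀ᵐ a ∂(S.arrival : Measure (Vec N)), ∀ p, a p ≤ A) :
    FinitelySupported S.transition := by
  intro q
  refine ⟨(fun sa : Vec N × Vec N => nextQueue q sa.1 sa.2) ''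
    (maxWeightSchedules q ×ˢ {a | ∀ p, a p ≤ A}),
    ((maxWeightSchedules_finite q).prod (bounded_arrivals_finite A)).image _, ?_⟩
  rw [transition_apply, Measure.map_apply Measurable.of_discrete MeasurableSet.of_discrete]
  refine measure_mono_null ?_ (ae_prod h_bdd q)
  intro sa hsa hgood
  exact hsa ⟨sa, hgood, rfl⟩

theorem integral_transition (q : Vec N) (φ : Vec N → ℝ) :
    ∫ z, φ z ∂S.transition q =
      ∫ sa, φ (nextQueue q sa.1 sa.2)
        ∂((S.schedule q : Measure (Vec N)).prod (S.arrival : Measure (Vec N))) := by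
  rw [transition_apply, integral_map Measurable.of_discrete.aemeasurable
    Measurable.of_discrete.aestronglyMeasurable]

/-- A pointwise bound over MaxWeight schedules and bounded arrivals gives a drift bound. -/
theorem integral_transition_le (h_bdd : ∀ᵐ a ∂(S.arrival : Measure (Vec N)), ∀ p, a p ≤ A)
    {q : Vec N} {φ χ : Vec N → ℝ}
    (h : ∀ s ∈ maxWeightSchedules q, ∀ a : Vec N, (∀ p, a p ≤ A) → φ (nextQueue q s a) ≤ χ a) :
    ∫ z, φ z ∂S.transition q ≤ ∫ a, χ a ∂(S.arrival : Measure (Vec N)) := by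
  have e : ∫ a, χ a ∂(S.arrival : Measure (Vec N)) =
      ∫ sa, χ sa.2 ∂((S.schedule q : Measure (Vec N)).prod (S.arrival : Measure (Vec N))) := by
    rw [integral_fun_snd]; simp
  rw [integral_transition, e]
  refine integral_mono_ae (integrable_prod h_bdd q _) (integrable_prod h_bdd q _) ?_
  filter_upwards [ae_prod h_bdd q] with sa hsa
  exact h _ hsa.1 _ hsa.2

/-- Expectation of an affine function of the arrivals. -/
theorem integral_affine (h_bdd : ∀ᵐ a ∂(S.arrival : Measure (Vec N)), ∀ p, a p ≤ A)
    (c : ℝ) (y : Fin N × Fin N → ℝ) :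
    ∫ a, (c + ∑ p, y p * (a p : ℝ)) ∂(S.arrival : Measure (Vec N)) =
      c + ∑ p, y p * ∫ a, (a p : ℝ) ∂(S.arrival : Measure (Vec N)) := by
  have hi := integrable_arrival h_bdd
  rw [integral_add (hi _) (hi _), integral_finsetSum _ fun p _ => hi _]
  simp_rw [integral_const_mul]
  simp

/-- Second moment, around an arbitrary point, of a sum of arrivals to distinct queues. -/
theorem integral_sq_sum_sub (h_bdd : ∀ᵐ a ∂(S.arrival : Measure (Vec N)), ∀ p, a p ≤ A)
    (h_indep : iIndepFun (fun (p : Fin N × Fin N) (a : Vec N) => a p)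
      (S.arrival : Measure (Vec N)))
    {ι : Type*} [Fintype ι] {g : ι → Fin N × Fin N} (hg : Function.Injective g) (c : ℝ) :
    ∫ a, (∑ j, (a (g j) : ℝ) - c) ^ 2 ∂(S.arrival : Measure (Vec N)) =
      ∑ j, variance (fun a : Vec N => (a (g j) : ℝ)) (S.arrival : Measure (Vec N)) +
        (∑ j, ∫ a, (a (g j) : ℝ) ∂(S.arrival : Measure (Vec N)) - c) ^ 2 := by
  have hi := integrable_arrival h_bdd
  have hmem : ∀ φ : Vec N → ℝ, MemLp φ 2 (S.arrival : Measure (Vec N)) := fun φ =>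
    (memLp_two_iff_integrable_sq Measurable.of_discrete.aestronglyMeasurable).2 (hi _)
  have h1 : iIndepFun (fun (j : ι) (a : Vec N) => (a (g j) : ℝ)) (S.arrival : Measure (Vec N)) :=
    (h_indep.precomp hg).comp (fun _ (n : ℕ) => (n : ℝ)) fun _ => Measurable.of_discrete
  have h2 := IndepFun.variance_sum (μ := (S.arrival : Measure (Vec N)))
    (X := fun (j : ι) (a : Vec N) => (a (g j) : ℝ)) (s := Finset.univ)
    (fun j _ => hmem _) (fun i _ j _ hij => h1.indepFun hij)
  rw [← h2, variance_eq_sub (hmem _)]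
  set X : Vec N → ℝ := ∑ j, fun a : Vec N => (a (g j) : ℝ) with hX
  have h3 : ∫ a, X a ∂(S.arrival : Measure (Vec N)) =
      ∑ j, ∫ a, (a (g j) : ℝ) ∂(S.arrival : Measure (Vec N)) := by
    rw [← integral_finsetSum _ fun p _ => hi _]
    refine integral_congr_ae (Eventually.of_forall fun a => ?_)
    simp [hX]
  rw [← h3]
  have h4 : ∀ a, (∑ j, (a (g j) : ℝ) - c) ^ 2 = X a ^ 2 + (-2 * c * X a + c ^ 2) := by
    intro a
    have : X a = ∑ j, (a (g j) : ℝ) := by simp [hX]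
    rw [this]; ring
  simp_rw [h4]
  rw [integral_add (hi _) (hi _), integral_add (hi _) (hi _), integral_const_mul]
  simp only [integral_const, probReal_univ, one_smul, Pi.pow_apply]
  ring

/-- If all arrival rates are below one, then no arrival occurs with positive probability. -/
theorem arrival_zero_ne_zero (h_bdd : ∀ᵐ a ∂(S.arrival : Measure (Vec N)), ∀ p, a p ≤ A)
    (h_indep : iIndepFun (fun (p : Fin N × Fin N) (a : Vec N) => a p)
      (S.arrival : Measure (Vec N)))
    (h_lt : ∀ p, ∫ a, (a p : ℝ) ∂(S.arrival : Measure (Vec N)) < 1) :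
    (S.arrival : Measure (Vec N)) {0} ≠ 0 := by
  have hi := integrable_arrival h_bdd
  have h1 := h_indep.measure_inter_preimage_eq_mul Finset.univ (sets := fun _ => {0})
    (fun p _ => MeasurableSet.of_discrete)
  have h2 : (⋂ p ∈ (Finset.univ : Finset (Fin N × Fin N)),
      (fun a : Vec N => a p) ⁻¹' {0}) = {0} := by
    ext a
    simp [funext_iff]
  rw [h2] at h1
  rw [h1, Finset.prod_ne_zero_iff]
  intro p _ h0
  refine (h_lt p).not_ge ?_
  have h3 : ∀ᵐ a ∂(S.arrival : Measure (Vec N)), (1 : ℝ) ≤ a p := by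
    filter_upwards [compl_mem_ae_iff.2 h0] with a ha
    have : a p ≠ 0 := by simpa using ha
    exact_mod_cast Nat.one_le_iff_ne_zero.2 this
  calc (1 : ℝ) = ∫ _, (1 : ℝ) ∂(S.arrival : Measure (Vec N)) := by simp
    _ ≤ _ := integral_mono_ae (hi _) (hi _) h3

/-- The finitely many MaxWeight schedules carry full mass, so one of them is an atom; independence
combines it with a slot without arrivals. -/
theorem exists_transition_ne_zero (h0 : (S.arrival : Measure (Vec N)) {0} ≠ 0) (q : Vec N) :
    ∃ s ∈ maxWeightSchedules q, S.transition q {nextQueue q s 0} ≠ 0 := by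
  obtain ⟨s, hs, hs0⟩ : ∃ s ∈ maxWeightSchedules q, (S.schedule q : Measure (Vec N)) {s} ≠ 0 := by
    by_contra! hcon
    have h1 : (S.schedule q : Measure (Vec N)) (maxWeightSchedules q) = 0 := by
      rw [← biUnion_of_singleton (maxWeightSchedules q),
        measure_biUnion_null_iff (maxWeightSchedules_finite q).countable]
      exact hcon
    have h2 : (S.schedule q : Measure (Vec N)) univ = 0 := by
      rw [← union_compl_self (maxWeightSchedules q)]
      exact measure_union_null h1 (S.schedule_maxWeight q)
    simp at h2
  refine ⟨s, hs, fun hz => ?_⟩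
  rw [transition_apply, Measure.map_apply Measurable.of_discrete MeasurableSet.of_discrete] at hz
  have h1 := measure_mono_null (s := {s} ×ˢ {0}) (by
    rintro ⟨s', a'⟩ ⟨rfl, rfl⟩
    simp) hz
  rw [Measure.prod_prod] at h1
  exact mul_ne_zero hs0 h0 h1

theorem transition_zero_zero_ne_zero (h0 : (S.arrival : Measure (Vec N)) {0} ≠ 0) :
    S.transition 0 {0} ≠ 0 := by
  obtain ⟨s, -, h⟩ := exists_transition_ne_zero h0 (0 : Vec N)
  have : nextQueue 0 s 0 = 0 := by ext p; simp [nextQueue]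
  rwa [this] at h

/-- Slots without arrivals empty the switch: each one strictly decreases a nonzero total, whence the
strong induction on the total. -/
theorem exists_pow_transition_zero_ne_zero (h0 : (S.arrival : Measure (Vec N)) {0} ≠ 0)
    (q : Vec N) : ∃ n, (S.transition ^ n) q {0} ≠ 0 := by
  induction hk : ∑ p, q p using Nat.strong_induction_on generalizing q with
  | _ k ih =>
    by_cases hq : q = 0
    · subst hq
      exact ⟨1, by rw [pow_one]; exact transition_zero_zero_ne_zero h0⟩
    · obtain ⟨s, hs, hpos⟩ := exists_transition_ne_zero h0 q
      obtain ⟨n, hn⟩ := ih _ (hk ▸ sum_nextQueue_zero_lt hq hs) _ rfl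
      refine ⟨1 + n, ?_⟩
      rw [Kernel.pow_add_apply_eq_lintegral _ 1 n q MeasurableSet.of_discrete, pow_one]
      intro hz
      have := setLIntegral_le_lintegral {nextQueue q s 0} (μ := S.transition q)
        (fun b => (S.transition ^ n) b {0})
      rw [lintegral_singleton, hz] at this
      simp_all

end MaxWeightSwitch
-- Distance to the cone of row and column indicators.
/-- The matrices all of whose row and column sums are nonpositive: the polar of the cone generated
by the indicators of rows and columns. -/
def polarCone (N : ℕ) : Set (Fin N × Fin N → ℝ) :=
  {y | (∀ i, ∑ j, y (i, j) ≤ 0) ∧ (∀ j, ∑ i, y (i, j) ≤ 0)}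

/-- Projection onto a closed convex cone in a Hilbert space. -/
theorem exists_cone_projection {H : Type*} [NormedAddCommGroup H] [InnerProductSpace ℝ H]
    [CompleteSpace H] {C : Set H} (h0 : (0 : H) ∈ C) (hclosed : IsClosed C) (hconv : Convex ℝ C)
    (hsmul : ∀ y ∈ C, (2 : ℝ) • y ∈ C) (x : H) :
    ∃ p ∈ C, inner ℝ (x - p) p = 0 ∧ ∀ y ∈ C, inner ℝ (x - p) y ≤ 0 := by
  obtain ⟨p, hp, hmin⟩ := exists_norm_eq_iInf_of_complete_convex ⟨0, h0⟩ hclosed.isComplete hconv x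
  have h := (norm_eq_iInf_iff_real_inner_le_zero hconv hp).1 hmin
  -- Testing the variational inequality at `0` and at `2p` yields both signs of the inner product,
  -- hence orthogonality.
  have h1 := h 0 h0
  have h2 := h _ (hsmul p hp)
  have e2 : (2 : ℝ) • p - p = p := by rw [two_smul]; abel
  rw [zero_sub, inner_neg_right] at h1
  rw [e2] at h2
  have h3 : inner ℝ (x - p) p = 0 := le_antisymm h2 (by linarith)
  refine ⟨p, hp, h3, fun y hy => ?_⟩
  have := h y hy
  rw [inner_sub_right, h3] at this
  linarith

/-- The projection is taken in `EuclideanSpace`, because plain functions carry the sup norm. By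
Moreau's decomposition, projecting onto the polar cone gives the component of `x` orthogonal to the
original cone, so that cone never has to be described explicitly. -/
theorem exists_polarCone_projection (x : Fin N × Fin N → ℝ) :
    ∃ p ∈ polarCone N, (x - p) ⬝ᵥ p = 0 ∧ ∀ y ∈ polarCone N, (x - p) ⬝ᵥ y ≤ 0 := by
  let C : Set (EuclideanSpace ℝ (Fin N × Fin N)) := {y | WithLp.ofLp y ∈ polarCone N}
  have hC : C = (⋂ i, {y : EuclideanSpace ℝ (Fin N × Fin N) | ∑ j, y (i, j) ≤ 0}) ∩ ⋂ j, {y : EuclideanSpace ℝ (Fin N × Fin N) | ∑ i, y (i, j) ≤ 0} := by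
    ext y; simp [C, polarCone]
  have hclosed : IsClosed C := by
    rw [hC]
    refine (isClosed_iInter fun i => isClosed_le ?_ continuous_const).inter
      (isClosed_iInter fun j => isClosed_le ?_ continuous_const) <;> fun_prop
  have hconv : Convex ℝ C := by
    intro y hy z hz a b ha hb _
    refine ⟨fun i => ?_, fun j => ?_⟩
    · have h1 := mul_nonpos_of_nonneg_of_nonpos ha (hy.1 i)
      have h2 := mul_nonpos_of_nonneg_of_nonpos hb (hz.1 i)
      simp only [WithLp.ofLp_add, WithLp.ofLp_smul, Pi.add_apply, Pi.smul_apply, smul_eq_mul,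
        Finset.sum_add_distrib, ← Finset.mul_sum]
      linarith
    · have h1 := mul_nonpos_of_nonneg_of_nonpos ha (hy.2 j)
      have h2 := mul_nonpos_of_nonneg_of_nonpos hb (hz.2 j)
      simp only [WithLp.ofLp_add, WithLp.ofLp_smul, Pi.add_apply, Pi.smul_apply, smul_eq_mul,
        Finset.sum_add_distrib, ← Finset.mul_sum]
      linarith
  have hinner : ∀ u v : EuclideanSpace ℝ (Fin N × Fin N), inner ℝ u v = WithLp.ofLp u ⬝ᵥ WithLp.ofLp v := by
    intro u v
    rw [EuclideanSpace.inner_eq_star_dotProduct, dotProduct_comm]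
    simp
  obtain ⟨p, hp, h1, h2⟩ := exists_cone_projection (C := C)
    ⟨fun i => by simp, fun j => by simp⟩ hclosed hconv (by
      intro y hy
      refine ⟨fun i => ?_, fun j => ?_⟩
      · have := hy.1 i
        simp only [WithLp.ofLp_smul, Pi.smul_apply, smul_eq_mul, ← Finset.mul_sum]
        linarith
      · have := hy.2 j
        simp only [WithLp.ofLp_smul, Pi.smul_apply, smul_eq_mul, ← Finset.mul_sum]
        linarith) (WithLp.toLp 2 x)
  refine ⟨WithLp.ofLp p, hp, ?_, fun y hy => ?_⟩
  · rw [hinner] at h1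
    simpa using h1
  · have := h2 (WithLp.toLp 2 y) hy
    rw [hinner] at this
    simpa using this

/-- The component of `x` orthogonal to the cone generated by the indicators of rows and columns. -/
noncomputable def perp (x : Fin N × Fin N → ℝ) : Fin N × Fin N → ℝ :=
  (exists_polarCone_projection x).choose

theorem perp_mem (x : Fin N × Fin N → ℝ) : perp x ∈ polarCone N :=
  (exists_polarCone_projection x).choose_spec.1

theorem sub_perp_dot_perp (x : Fin N × Fin N → ℝ) : (x - perp x) ⬝ᵥ perp x = 0 :=
  (exists_polarCone_projection x).choose_spec.2.1

theorem sub_perp_dot_le (x : Fin N × Fin N → ℝ) {y : Fin N × Fin N → ℝ} (hy : y ∈ polarCone N) :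
    (x - perp x) ⬝ᵥ y ≤ 0 :=
  (exists_polarCone_projection x).choose_spec.2.2 y hy

theorem dot_perp (x : Fin N × Fin N → ℝ) : x ⬝ᵥ perp x = perp x ⬝ᵥ perp x := by
  have := sub_perp_dot_perp x
  rw [sub_dotProduct] at this
  linarith

theorem two_mul_dot_le {ι : Type*} [Fintype ι] (x y : ι → ℝ) :
    2 * (x ⬝ᵥ y) ≤ x ⬝ᵥ x + y ⬝ᵥ y := by
  simp only [dotProduct, Finset.mul_sum, ← Finset.sum_add_distrib]
  exact Finset.sum_le_sum fun p _ => by nlinarith [sq_nonneg (x p - y p)]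

theorem add_dot_self {ι : Type*} [Fintype ι] (x y : ι → ℝ) :
    (x + y) ⬝ᵥ (x + y) = x ⬝ᵥ x + 2 * (x ⬝ᵥ y) + y ⬝ᵥ y := by
  rw [add_dotProduct, dotProduct_add, dotProduct_add, dotProduct_comm y x]; ring

theorem dot_self_nonneg {ι : Type*} [Fintype ι] (x : ι → ℝ) : 0 ≤ x ⬝ᵥ x :=
  Finset.sum_nonneg fun _ _ => mul_self_nonneg _

theorem abs_le_sqrt_dot_self {ι : Type*} [Fintype ι] (x : ι → ℝ) (p : ι) :
    |x p| ≤ √(x ⬝ᵥ x) := by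
  refine Real.abs_le_sqrt ?_
  rw [sq]
  exact Finset.single_le_sum (f := fun p => x p * x p) (fun _ _ => mul_self_nonneg _)
    (Finset.mem_univ p)

/-- Membership of `z` in the cone is expressed by duality. Pairing `x - z` with `perp x` gives at
least the squared norm of `perp x`, so no such `z` is closer to `x`. -/
theorem perp_dot_self_le_of_polar {x z : Fin N × Fin N → ℝ}
    (hz : ∀ y ∈ polarCone N, z ⬝ᵥ y ≤ 0) : perp x ⬝ᵥ perp x ≤ (x - z) ⬝ᵥ (x - z) := by
  have h1 := two_mul_dot_le (x - z) (perp x)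
  have h2 := hz _ (perp_mem x)
  rw [sub_dotProduct x z (perp x), dot_perp] at h1
  linarith

/-- Used for `y` the residual of `x` off the span of the cone: the distance to the span is at most
the distance to the cone. -/
theorem dot_self_le_perp {x y : Fin N × Fin N → ℝ} (hy : y ∈ polarCone N) (hxy : y ⬝ᵥ y = x ⬝ᵥ y) :
    y ⬝ᵥ y ≤ perp x ⬝ᵥ perp x := by
  have h1 := sub_perp_dot_le x hy
  rw [sub_dotProduct] at h1
  have h2 := two_mul_dot_le (perp x) y
  linarith

theorem perp_dot_self_le (x : Fin N × Fin N → ℝ) : perp x ⬝ᵥ perp x ≤ x ⬝ᵥ x := by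
  simpa using perp_dot_self_le_of_polar (x := x) (z := 0) (by simp)

/-- The matrix `r i * c j / ∑ r`, with row sums `r` and column sums `c`. -/
noncomputable def fill (r c : Fin N → ℝ) : Fin N × Fin N → ℝ := fun p => r p.1 * c p.2 / ∑ i, r i

theorem fill_nonneg {r c : Fin N → ℝ} (hr : ∀ i, 0 ≤ r i) (hc : ∀ j, 0 ≤ c j)
    (p : Fin N × Fin N) : 0 ≤ fill r c p :=
  div_nonneg (mul_nonneg (hr _) (hc _)) (Finset.sum_nonneg fun i _ => hr i)

/-- If the total is zero, division by zero makes `fill` vanish, which is consistent because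
nonnegativity forces every `r i` to vanish. -/
theorem sum_fill_row {r c : Fin N → ℝ} (hr : ∀ i, 0 ≤ r i) (h : ∑ i, r i = ∑ j, c j) (i : Fin N) :
    ∑ j, fill r c (i, j) = r i := by
  simp only [fill, ← Finset.sum_div, ← Finset.mul_sum, ← h]
  by_cases hk : ∑ i, r i = 0
  · rw [hk, (Finset.sum_eq_zero_iff_of_nonneg fun i _ => hr i).1 hk i (Finset.mem_univ _)]
    simp
  · field_simp

theorem sum_fill_col {r c : Fin N → ℝ} (hc : ∀ j, 0 ≤ c j) (h : ∑ i, r i = ∑ j, c j) (j : Fin N) :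
    ∑ i, fill r c (i, j) = c j := by
  simp only [fill, ← Finset.sum_div, ← Finset.sum_mul]
  by_cases hk : ∑ i, r i = 0
  · rw [hk, (Finset.sum_eq_zero_iff_of_nonneg fun i _ => hc i).1 (h ▸ hk) j (Finset.mem_univ _)]
    simp
  · field_simp

/-! ### Optimality of MaxWeight and one-step bounds. -/

/-- The vector of queue lengths, as a real vector. -/
def toReal (q : Vec N) : Fin N × Fin N → ℝ := fun p => (q p : ℝ)

theorem toReal_dot (q x : Vec N) : toReal q ⬝ᵥ toReal x = (weight q x : ℝ) := by
  simp [toReal, weight, dotProduct]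

/-- MaxWeight dominates every doubly substochastic service rate. -/
theorem dot_le_of_maxWeight {q s : Vec N} (hs : s ∈ maxWeightSchedules q) {y : Fin N × Fin N → ℝ}
    (hy : ∀ p, 0 ≤ y p) (hrow : ∀ i, ∑ j, y (i, j) ≤ 1) (hcol : ∀ j, ∑ i, y (i, j) ≤ 1) :
    toReal q ⬝ᵥ y ≤ toReal q ⬝ᵥ toReal s := by
  classical
  set r : Fin N → ℝ := fun i => 1 - ∑ j, y (i, j) with hr
  set c : Fin N → ℝ := fun j => 1 - ∑ i, y (i, j) with hc
  have hr0 : ∀ i, 0 ≤ r i := fun i => sub_nonneg.2 (hrow i)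
  have hc0 : ∀ j, 0 ≤ c j := fun j => sub_nonneg.2 (hcol j)
  have hrc : ∑ i, r i = ∑ j, c j := by
    simp only [hr, hc, Finset.sum_sub_distrib]
    rw [Finset.sum_comm]
  -- Filling in the row and column slacks makes `y` doubly stochastic; Birkhoff's theorem then
  -- writes it as a mixture of permutation schedules, each dominated by `s`.
  let M : Matrix (Fin N) (Fin N) ℝ := fun i j => y (i, j) + fill r c (i, j)
  have hM : M ∈ doublyStochastic ℝ (Fin N) := by
    rw [mem_doublyStochastic_iff_sum]
    refine ⟨fun i j => add_nonneg (hy _) (fill_nonneg hr0 hc0 _), fun i => ?_, fun j => ?_⟩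
    · simp only [M, Finset.sum_add_distrib, sum_fill_row hr0 hrc]; simp [hr]
    · simp only [M, Finset.sum_add_distrib, sum_fill_col hc0 hrc]; simp [hc]
  obtain ⟨w, hw0, hw1, hwM⟩ := exists_eq_sum_perm_of_mem_doublyStochastic hM
  let x : Equiv.Perm (Fin N) → Vec N := fun τ p => if τ p.1 = p.2 then 1 else 0
  have hx : ∀ τ, x τ ∈ feasible N := by
    refine fun τ => ⟨fun p => ?_, fun i => ?_, fun j => ?_⟩
    · by_cases h : τ p.1 = p.2 <;> simp [x, h]
    · simp [x]
    · simp [x, ← Equiv.eq_symm_apply]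
  have hMx : ∀ p : Fin N × Fin N, M p.1 p.2 = ∑ τ, w τ * toReal (x τ) p := by
    intro p
    rw [← hwM]
    simp [Matrix.sum_apply, x, toReal, Equiv.toPEquiv_apply, PEquiv.toMatrix_apply]
  calc toReal q ⬝ᵥ y ≤ ∑ p, toReal q p * M p.1 p.2 := by
        refine Finset.sum_le_sum fun p _ => mul_le_mul_of_nonneg_left ?_ (Nat.cast_nonneg _)
        exact le_add_of_nonneg_right (fill_nonneg hr0 hc0 _)
    _ = ∑ τ, w τ * (toReal q ⬝ᵥ toReal (x τ)) := by
        simp_rw [hMx, dotProduct, Finset.mul_sum]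
        rw [Finset.sum_comm]
        refine Finset.sum_congr rfl fun τ _ => Finset.sum_congr rfl fun p _ => by ring
    _ ≤ ∑ τ, w τ * (toReal q ⬝ᵥ toReal s) := by
        refine Finset.sum_le_sum fun τ _ => mul_le_mul_of_nonneg_left ?_ (hw0 τ)
        rw [toReal_dot, toReal_dot]
        exact_mod_cast hs.2 _ (hx τ)
    _ = _ := by rw [← Finset.sum_mul, hw1, one_mul]

/-- With strictly positive saturated rates, the MaxWeight advantage grows with the distance to
the cone. -/
theorem dot_add_perp_le_of_maxWeight {q s : Vec N} (hs : s ∈ maxWeightSchedules q)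
    {ν : Fin N × Fin N → ℝ} {δ : ℝ} (hδ : 0 < δ) (hν : ∀ p, δ ≤ ν p)
    (hrow : ∀ i, ∑ j, ν (i, j) = 1) (hcol : ∀ j, ∑ i, ν (i, j) = 1) :
    toReal q ⬝ᵥ ν + δ * √(perp (toReal q) ⬝ᵥ perp (toReal q)) ≤ toReal q ⬝ᵥ toReal s := by
  set p := perp (toReal q) with hp
  set f := √(p ⬝ᵥ p) with hf
  have hf2 : f * f = p ⬝ᵥ p := Real.mul_self_sqrt (dot_self_nonneg _)
  rcases (Real.sqrt_nonneg (p ⬝ᵥ p)).eq_or_lt with h0 | hpos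
  · rw [← hf] at h0
    rw [← h0, mul_zero, add_zero]
    exact dot_le_of_maxWeight hs (fun r => hδ.le.trans (hν r)) (fun i => (hrow i).le)
      fun j => (hcol j).le
  · rw [← hf] at hpos
    have hmem := perp_mem (toReal q)
    rw [← hp] at hmem
    -- Moving `ν` by length `δ` along `p` keeps it admissible: entries change by at most `δ`, and
    -- sums do not grow because `p` is in the polar cone. The gain is `(δ / f) (q · p) = δ f`.
    have h1 := dot_le_of_maxWeight (y := ν + (δ / f) • p) hs (fun r => ?_) (fun i => ?_)
      (fun j => ?_)
    · rw [dotProduct_add, dotProduct_smul, hp, dot_perp, ← hp, ← hf2, smul_eq_mul] at h1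
      have : δ / f * (f * f) = δ * f := by field_simp
      linarith
    · have h2 := (abs_le.1 (abs_le_sqrt_dot_self p r)).1
      rw [← hf] at h2
      have h3 : δ / f * (-f) ≤ δ / f * p r := mul_le_mul_of_nonneg_left h2 (by positivity)
      have h4 : δ / f * (-f) = -δ := by field_simp
      have h5 := hν r
      simp only [Pi.add_apply, Pi.smul_apply, smul_eq_mul]
      linarith
    · have := mul_nonpos_of_nonneg_of_nonpos (show 0 ≤ δ / f by positivity) (hmem.1 i)
      simp only [Pi.add_apply, Pi.smul_apply, smul_eq_mul, Finset.sum_add_distrib,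
        ← Finset.mul_sum, hrow]
      linarith
    · have := mul_nonpos_of_nonneg_of_nonpos (show 0 ≤ δ / f by positivity) (hmem.2 j)
      simp only [Pi.add_apply, Pi.smul_apply, smul_eq_mul, Finset.sum_add_distrib,
        ← Finset.mul_sum, hcol]
      linarith

/-- The unused service. -/
def unused (q s a : Vec N) : Fin N × Fin N → ℝ := fun p => if q p = 0 ∧ a p = 0 then s p else 0

section step

variable {q s a : Vec N}

theorem unused_nonneg (p : Fin N × Fin N) : 0 ≤ unused q s a p := by
  unfold unused; split_ifs <;> simp

theorem unused_le (p : Fin N × Fin N) : unused q s a p ≤ s p := by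
  unfold unused; split_ifs <;> simp

theorem dot_unused : toReal q ⬝ᵥ unused q s a = 0 := by
  refine Finset.sum_eq_zero fun p _ => ?_
  unfold unused toReal
  split_ifs with h <;> simp [h]

/-- Service is at most one, so truncation only acts when both the queue and the arrival are zero. -/
theorem toReal_nextQueue (hs : s ∈ feasible N) :
    toReal (nextQueue q s a) = toReal q + (toReal a - toReal s + unused q s a) := by
  ext p
  simp only [toReal, nextQueue, unused, Pi.add_apply, Pi.sub_apply]
  split_ifs with h
  · rw [h.1, h.2]; simp
  · have h1 : s p ≤ 1 := by rcases hs.1 p with h | h <;> omega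
    have h2 : s p ≤ q p + a p := by
      by_contra hlt
      exact h ⟨by omega, by omega⟩
    rw [Nat.cast_sub h2]; push_cast; ring

theorem unused_mul_nextQueue (p : Fin N × Fin N) :
    unused q s a p * toReal (nextQueue q s a) p = 0 := by
  unfold unused toReal nextQueue
  split_ifs with h
  · simp [h.1, h.2]
  · simp

theorem step_abs_le {A : ℕ} (hs : s ∈ feasible N) (ha : ∀ p, a p ≤ A) (p : Fin N × Fin N) :
    |(toReal a - toReal s + unused q s a) p| ≤ A + 1 := by
  have h1 := unused_nonneg (q := q) (s := s) (a := a) p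
  have h2 := unused_le (q := q) (s := s) (a := a) p
  have h3 : (s p : ℝ) ≤ 1 := by
    have : s p ≤ 1 := by rcases hs.1 p with h | h <;> omega
    exact_mod_cast this
  have h4 : (a p : ℝ) ≤ A := by exact_mod_cast ha p
  have h5 : (0 : ℝ) ≤ a p := Nat.cast_nonneg _
  have h6 : (0 : ℝ) ≤ A := Nat.cast_nonneg _
  simp only [toReal, Pi.add_apply, Pi.sub_apply]
  rw [abs_le]
  constructor <;> linarith

theorem step_dot_self_le {A : ℕ} (hs : s ∈ feasible N) (ha : ∀ p, a p ≤ A) :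
    (toReal a - toReal s + unused q s a) ⬝ᵥ (toReal a - toReal s + unused q s a) ≤
      (N * N : ℝ) * (A + 1) ^ 2 := by
  have : ∀ p, (toReal a - toReal s + unused q s a) p * (toReal a - toReal s + unused q s a) p ≤
      ((A : ℝ) + 1) ^ 2 := by
    intro p
    have := step_abs_le (q := q) hs ha p
    rw [← sq, ← sq_abs]
    exact pow_le_pow_left₀ (abs_nonneg _) this 2
  refine (Finset.sum_le_sum fun p _ => this p).trans ?_
  simp

theorem neg_unused_mem_polarCone : -unused q s a ∈ polarCone N := by
  constructor <;> intro i <;> simp only [Pi.neg_apply, Finset.sum_neg_distrib, neg_nonpos] <;>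
    exact Finset.sum_nonneg fun j _ => unused_nonneg _

theorem schedule_sub_mem_polarCone (hs : s ∈ feasible N) {ν : Fin N × Fin N → ℝ}
    (hrow : ∀ i, ∑ j, ν (i, j) = 1) (hcol : ∀ j, ∑ i, ν (i, j) = 1) :
    toReal s - ν ∈ polarCone N := by
  refine ⟨fun i => ?_, fun j => ?_⟩
  · simp only [Pi.sub_apply, Finset.sum_sub_distrib, hrow, toReal, sub_nonpos]
    exact_mod_cast hs.2.1 i
  · simp only [Pi.sub_apply, Finset.sum_sub_distrib, hcol, toReal, sub_nonpos]
    exact_mod_cast hs.2.2 j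

/-- One-step bound for the squared distance to the cone. -/
theorem perp_dot_self_step_le {A : ℕ} (hs : s ∈ maxWeightSchedules q) (ha : ∀ p, a p ≤ A)
    {ν : Fin N × Fin N → ℝ} {δ : ℝ} (hδ : 0 < δ) (hν : ∀ p, δ ≤ ν p)
    (hrow : ∀ i, ∑ j, ν (i, j) = 1) (hcol : ∀ j, ∑ i, ν (i, j) = 1) {ε : ℝ} (hε : 0 ≤ ε) :
    perp (toReal (nextQueue q s a)) ⬝ᵥ perp (toReal (nextQueue q s a)) ≤
      perp (toReal q) ⬝ᵥ perp (toReal q) + 2 * (perp (toReal q) ⬝ᵥ (toReal a - (1 - ε) • ν))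
        - 2 * (δ - ε * N) * √(perp (toReal q) ⬝ᵥ perp (toReal q)) + (N * N : ℝ) * (A + 1) ^ 2 := by
  -- The old nearest point `q - perp q` is kept as a competitor for the new vector.
  have h1 := perp_dot_self_le_of_polar (x := toReal (nextQueue q s a))
    (z := toReal q - perp (toReal q)) (fun y hy => sub_perp_dot_le _ hy)
  refine h1.trans ?_
  set p := perp (toReal q) with hp
  set Δ := toReal a - toReal s + unused q s a with hΔ
  have e1 : toReal (nextQueue q s a) - (toReal q - p) = p + Δ := by
    rw [toReal_nextQueue hs.1, ← hΔ]; abel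
  have hD : Δ ⬝ᵥ Δ ≤ (N * N : ℝ) * (A + 1) ^ 2 := step_dot_self_le hs.1 ha
  have e2 : (p + Δ) ⬝ᵥ (p + Δ) = p ⬝ᵥ p + 2 * (p ⬝ᵥ Δ) + Δ ⬝ᵥ Δ := add_dot_self _ _
  have e3 : p ⬝ᵥ Δ = p ⬝ᵥ (toReal a - (1 - ε) • ν) + (p ⬝ᵥ ν - p ⬝ᵥ toReal s)
      + p ⬝ᵥ unused q s a - ε * (p ⬝ᵥ ν) := by
    rw [hΔ, dotProduct_add, dotProduct_sub, dotProduct_sub, dotProduct_smul, smul_eq_mul]; ring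
  -- Polarity makes `p · unused` nonpositive, as unused service is orthogonal to `q`. In `h3` it
  -- transfers the MaxWeight advantage from `q` to `p`.
  have h2 := sub_perp_dot_le (toReal q) (neg_unused_mem_polarCone (q := q) (s := s) (a := a))
  rw [← hp, dotProduct_neg, sub_dotProduct, dot_unused] at h2
  have h3 := sub_perp_dot_le (toReal q) (schedule_sub_mem_polarCone hs.1 hrow hcol)
  rw [← hp, dotProduct_sub, sub_dotProduct, sub_dotProduct] at h3
  have h4 := dot_add_perp_le_of_maxWeight hs hδ hν hrow hcol
  rw [← hp] at h4
  have h5 : -(p ⬝ᵥ ν) ≤ N * √(p ⬝ᵥ p) := by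
    have hsum : ∑ r, ν r = N := by
      rw [Fintype.sum_prod_type]; simp [hrow]
    rw [← hsum, Finset.sum_mul, dotProduct, ← Finset.sum_neg_distrib]
    refine Finset.sum_le_sum fun r _ => ?_
    have h6 := (abs_le.1 (abs_le_sqrt_dot_self p r)).1
    have h7 := hδ.le.trans (hν r)
    nlinarith
  have h6 := mul_le_mul_of_nonneg_left h5 hε
  rw [e1, e2, e3]
  linarith

/-- One-step bound for the squared Euclidean norm. -/
theorem dot_self_step_le {A : ℕ} (hs : s ∈ maxWeightSchedules q) (ha : ∀ p, a p ≤ A)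
    {ν : Fin N × Fin N → ℝ} {δ : ℝ} (hδ : 0 < δ) (hν : ∀ p, δ ≤ ν p)
    (hrow : ∀ i, ∑ j, ν (i, j) = 1) (hcol : ∀ j, ∑ i, ν (i, j) = 1) {ε : ℝ} (hε : 0 ≤ ε) :
    toReal (nextQueue q s a) ⬝ᵥ toReal (nextQueue q s a) ≤
      toReal q ⬝ᵥ toReal q + 2 * (toReal q ⬝ᵥ (toReal a - (1 - ε) • ν))
        - 2 * ε * δ * √(toReal q ⬝ᵥ toReal q) + (N * N : ℝ) * (A + 1) ^ 2 := by
  set Δ := toReal a - toReal s + unused q s a with hΔ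
  have hD : Δ ⬝ᵥ Δ ≤ (N * N : ℝ) * (A + 1) ^ 2 := step_dot_self_le hs.1 ha
  have e2 : (toReal q + Δ) ⬝ᵥ (toReal q + Δ) =
      toReal q ⬝ᵥ toReal q + 2 * (toReal q ⬝ᵥ Δ) + Δ ⬝ᵥ Δ := add_dot_self _ _
  have e3 : toReal q ⬝ᵥ Δ = toReal q ⬝ᵥ (toReal a - (1 - ε) • ν)
      + (toReal q ⬝ᵥ ν - toReal q ⬝ᵥ toReal s) - ε * (toReal q ⬝ᵥ ν) := by
    rw [hΔ, dotProduct_add, dotProduct_sub, dotProduct_sub, dotProduct_smul, smul_eq_mul,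
      dot_unused]; ring
  have h4 := dot_le_of_maxWeight hs (fun r => hδ.le.trans (hν r)) (fun i => (hrow i).le)
      fun j => (hcol j).le
  have h5 : √(toReal q ⬝ᵥ toReal q) ≤ ∑ r, toReal q r := by
    have h0 : ∀ r, 0 ≤ toReal q r := fun r => Nat.cast_nonneg _
    refine Real.sqrt_le_iff.2 ⟨Finset.sum_nonneg fun r _ => h0 r, ?_⟩
    rw [sq, Finset.sum_mul]
    exact Finset.sum_le_sum fun r _ => mul_le_mul_of_nonneg_left
      (Finset.single_le_sum (fun r _ => h0 r) (Finset.mem_univ r)) (h0 r)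
  have h6 : δ * ∑ r, toReal q r ≤ toReal q ⬝ᵥ ν := by
    rw [Finset.mul_sum]
    exact Finset.sum_le_sum fun r _ => by
      rw [mul_comm]; exact mul_le_mul_of_nonneg_left (hν r) (Nat.cast_nonneg _)
  have h7 : ε * (δ * √(toReal q ⬝ᵥ toReal q)) ≤ ε * (toReal q ⬝ᵥ ν) :=
    mul_le_mul_of_nonneg_left ((mul_le_mul_of_nonneg_left h5 hδ.le).trans h6) hε
  rw [toReal_nextQueue hs.1, e2, e3]
  linarith

end step

theorem abs_dot_le {ι : Type*} [Fintype ι] (x y : ι → ℝ) {b : ℝ} (hy : ∀ p, |y p| ≤ b) :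
    |x ⬝ᵥ y| ≤ √(x ⬝ᵥ x) * (Fintype.card ι * b) := by
  refine (Finset.abs_sum_le_sum_abs _ _).trans ?_
  calc ∑ p, |x p * y p| ≤ ∑ _p : ι, √(x ⬝ᵥ x) * b := by
        refine Finset.sum_le_sum fun p _ => ?_
        rw [abs_mul]
        exact mul_le_mul (abs_le_sqrt_dot_self x p) (hy p) (abs_nonneg _) (Real.sqrt_nonneg _)
    _ = _ := by simp; ring

/-! ### Geometric drift, the steady state and state space collapse. -/

namespace MaxWeightSwitch

/-- The standing assumptions on a switch with load `1 - ε`. -/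
structure IsLoaded (S : MaxWeightSwitch N) (A : ℕ) (ν : Fin N × Fin N → ℝ) (δ ε : ℝ) : Prop where
  bdd : ∀ᵐ a ∂(S.arrival : Measure (Vec N)), ∀ p, a p ≤ A
  mean : ∀ p, ∫ a, (a p : ℝ) ∂(S.arrival : Measure (Vec N)) = (1 - ε) * ν p
  indep : iIndepFun (fun (p : Fin N × Fin N) (a : Vec N) => a p) (S.arrival : Measure (Vec N))
  delta_pos : 0 < δ
  delta_le : ∀ p, δ ≤ ν p
  row : ∀ i, ∑ j, ν (i, j) = 1
  col : ∀ j, ∑ i, ν (i, j) = 1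
  eps_pos : 0 < ε
  eps_lt : ε < 1
  size_pos : 1 ≤ N

namespace IsLoaded

variable {S : MaxWeightSwitch N} {A : ℕ} {ν : Fin N × Fin N → ℝ} {δ ε : ℝ}

theorem rate_le_one (h : S.IsLoaded A ν δ ε) (p : Fin N × Fin N) : ν p ≤ 1 := by
  rw [← h.row p.1]
  exact Finset.single_le_sum (f := fun j => ν (p.1, j))
    (fun j _ => h.delta_pos.le.trans (h.delta_le _)) (Finset.mem_univ p.2)

theorem delta_le_one (h : S.IsLoaded A ν δ ε) : δ ≤ 1 :=
  (h.delta_le (⟨0, h.size_pos⟩, ⟨0, h.size_pos⟩)).trans (h.rate_le_one _)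

theorem abs_centered_le (h : S.IsLoaded A ν δ ε) {a : Vec N} (ha : ∀ p, a p ≤ A)
    (p : Fin N × Fin N) : |(toReal a - (1 - ε) • ν) p| ≤ A + 1 := by
  have h1 := h.rate_le_one p
  have h2 := h.delta_pos.trans_le (h.delta_le p)
  have h3 : (a p : ℝ) ≤ A := by exact_mod_cast ha p
  have h4 : (0 : ℝ) ≤ a p := Nat.cast_nonneg _
  have h5 := h.eps_pos
  have h6 := h.eps_lt
  simp only [toReal, Pi.sub_apply, Pi.smul_apply, smul_eq_mul]
  rw [abs_le]
  constructor <;> nlinarith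

theorem abs_dot_centered_le (h : S.IsLoaded A ν δ ε) {a : Vec N} (ha : ∀ p, a p ≤ A)
    (x : Fin N × Fin N → ℝ) :
    |x ⬝ᵥ (toReal a - (1 - ε) • ν)| ≤ √(x ⬝ᵥ x) * (N * N * (A + 1)) := by
  simpa using abs_dot_le x _ (h.abs_centered_le ha)

theorem integral_centered (h : S.IsLoaded A ν δ ε) (c k : ℝ) (x : Fin N × Fin N → ℝ) :
    ∫ a, (c + k * (x ⬝ᵥ (toReal a - (1 - ε) • ν))) ∂(S.arrival : Measure (Vec N)) = c := by
  have e : ∀ a : Vec N, c + k * (x ⬝ᵥ (toReal a - (1 - ε) • ν)) =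
      (c - k * (x ⬝ᵥ ((1 - ε) • ν))) + ∑ p, (k * x p) * (a p : ℝ) := by
    intro a
    rw [dotProduct_sub]
    have : k * (x ⬝ᵥ toReal a) = ∑ p, (k * x p) * (a p : ℝ) := by
      rw [dotProduct, Finset.mul_sum]
      exact Finset.sum_congr rfl fun p _ => by simp only [toReal]; ring
    rw [← this]; ring
  simp_rw [e]
  rw [integral_affine h.bdd]
  simp_rw [h.mean]
  have : k * (x ⬝ᵥ ((1 - ε) • ν)) = ∑ p, (k * x p) * ((1 - ε) * ν p) := by
    rw [dotProduct, Finset.mul_sum]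
    exact Finset.sum_congr rfl fun p _ => by simp only [Pi.smul_apply, smul_eq_mul]; ring
  rw [this]; ring

/-- Completing the square gives `√y ≤ g + z`, and the exponential is expanded to second order, which
needs `|θ z| ≤ 1`. The result is affine in `z`, so centered arrivals integrate out. -/
theorem exp_mul_sqrt_le {θ c g z y : ℝ} (hθ : 0 < θ) (hg : 0 < g) (hy0 : 0 ≤ y)
    (hy : y ≤ g * g + 2 * g * z) (hz : |z| ≤ c) (hθc : θ * c ≤ 1) :
    Real.exp (θ * √y) ≤ Real.exp (θ * g) * (1 + θ * z + θ ^ 2 * c ^ 2) := by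
  have h4 : 0 ≤ g * (g + 2 * z) := by linarith
  have h5 : 0 ≤ g + 2 * z := nonneg_of_mul_nonneg_right h4 hg
  have h6 : √y ≤ g + z := Real.sqrt_le_iff.2 ⟨by linarith, by nlinarith [sq_nonneg z]⟩
  have hθz : |θ * z| ≤ 1 := by
    rw [abs_mul, abs_of_pos hθ]
    exact (mul_le_mul_of_nonneg_left hz hθ.le).trans hθc
  have h7 := (abs_le.1 (Real.abs_exp_sub_one_sub_id_le hθz)).2
  have h8 : z ^ 2 ≤ c ^ 2 := by
    rw [← sq_abs]; exact pow_le_pow_left₀ (abs_nonneg _) hz 2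
  have h9 : Real.exp (θ * z) ≤ 1 + θ * z + θ ^ 2 * c ^ 2 := by
    have : (θ * z) ^ 2 ≤ θ ^ 2 * c ^ 2 := by
      rw [mul_pow]; exact mul_le_mul_of_nonneg_left h8 (sq_nonneg _)
    linarith
  calc Real.exp (θ * √y) ≤ Real.exp (θ * (g + z)) :=
        Real.exp_le_exp.2 (mul_le_mul_of_nonneg_left h6 hθ.le)
    _ = Real.exp (θ * g) * Real.exp (θ * z) := by rw [mul_add, Real.exp_add]
    _ ≤ _ := mul_le_mul_of_nonneg_left h9 (Real.exp_pos _).le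

/-- Crude one-step bound of the exponential Lyapunov function near the origin. -/
theorem integral_exp_le_of_lt (h : S.IsLoaded A ν δ ε) {θ G : ℝ} (hθ : 0 < θ) (hG : 1 ≤ G)
    {q : Vec N} (hq : √(toReal q ⬝ᵥ toReal q) < G) :
    ∫ z, Real.exp (θ * √(toReal z ⬝ᵥ toReal z)) ∂S.transition q ≤
      Real.exp (θ * (G + N * N * (A + 1) + N * N * (A + 1) ^ 2)) := by
  set L : ℝ := N * N * (A + 1) with hL
  set D : ℝ := N * N * (A + 1) ^ 2 with hD
  have hL0 : 0 ≤ L := by positivity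
  have hD0 : 0 ≤ D := by positivity
  set g := √(toReal q ⬝ᵥ toReal q) with hg
  have hg0 : 0 ≤ g := Real.sqrt_nonneg _
  have hgg : g * g = toReal q ⬝ᵥ toReal q := Real.mul_self_sqrt (dot_self_nonneg _)
  have hmain := integral_transition_le (S := S) h.bdd (q := q)
    (φ := fun z => Real.exp (θ * √(toReal z ⬝ᵥ toReal z)))
    (χ := fun _ => Real.exp (θ * (G + L + D))) (fun s hs a ha => by
      refine Real.exp_le_exp.2 (mul_le_mul_of_nonneg_left ?_ hθ.le)
      refine Real.sqrt_le_iff.2 ⟨by linarith, ?_⟩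
      have h1 := dot_self_step_le hs ha h.delta_pos h.delta_le h.row h.col h.eps_pos.le
      have h2 := (abs_le.1 (h.abs_dot_centered_le ha (toReal q))).2
      rw [← hg, ← hL] at h2
      rw [← hg, ← hgg, ← hD] at h1
      have h3 : 0 ≤ 2 * ε * δ * g := by
        have := h.eps_pos; have := h.delta_pos; positivity
      have h4 : (g + L) ^ 2 ≤ (G + L) ^ 2 := pow_le_pow_left₀ (by linarith) (by linarith) 2
      have h5 : D * 1 ≤ D * (2 * (G + L)) := mul_le_mul_of_nonneg_left (by linarith) hD0
      have h6 := sq_nonneg L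
      have h7 := sq_nonneg D
      calc _ ≤ (g + L) ^ 2 + D := by linarith
        _ ≤ (G + L) ^ 2 + D * (2 * (G + L)) + D ^ 2 := by linarith
        _ = _ := by ring)
  simpa only [integral_const, probReal_univ, one_smul] using hmain

/-- One-step contraction of the exponential Lyapunov function away from the origin. -/
theorem integral_exp_le_of_ge (h : S.IsLoaded A ν δ ε) {θ c : ℝ} (hθ : 0 < θ)
    (hc : N * N * (A + 1) + 1 + N * N * (A + 1) ^ 2 ≤ c) (hθc : θ * c ≤ 1)
    (hθc2 : θ * c ^ 2 = ε * δ / 4) {q : Vec N} (hq1 : 1 ≤ √(toReal q ⬝ᵥ toReal q))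
    (hq : 2 * (N * N * (A + 1) ^ 2 : ℝ) ≤ ε * δ * √(toReal q ⬝ᵥ toReal q)) :
    ∫ z, Real.exp (θ * √(toReal z ⬝ᵥ toReal z)) ∂S.transition q ≤
      (1 - θ * (ε * δ) / 2) * Real.exp (θ * √(toReal q ⬝ᵥ toReal q)) := by
  set L : ℝ := N * N * (A + 1) with hL
  set D : ℝ := N * N * (A + 1) ^ 2 with hD
  have hL0 : 0 ≤ L := by positivity
  have hD0 : 0 ≤ D := by positivity
  set η := ε * δ with hη
  have hη0 : 0 < η := mul_pos h.eps_pos h.delta_pos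
  have hη1 : η ≤ 1 := mul_le_one₀ h.eps_lt.le h.delta_pos.le h.delta_le_one
  set g := √(toReal q ⬝ᵥ toReal q) with hg
  have hgg : g * g = toReal q ⬝ᵥ toReal q := Real.mul_self_sqrt (dot_self_nonneg _)
  have hgpos : 0 < g := by linarith
  set k := Real.exp (θ * g) with hk
  have hk0 : 0 < k := Real.exp_pos _
  have hmain := integral_transition_le (S := S) h.bdd (q := q)
    (φ := fun z => Real.exp (θ * √(toReal z ⬝ᵥ toReal z)))
    (χ := fun a => k * (1 + θ * (-η + D / (2 * g)) + θ ^ 2 * c ^ 2) +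
      (k * θ / g) * (toReal q ⬝ᵥ (toReal a - (1 - ε) • ν))) (fun s hs a ha => by
      set X := toReal q ⬝ᵥ (toReal a - (1 - ε) • ν) with hX
      have h1 := dot_self_step_le hs ha h.delta_pos h.delta_le h.row h.col h.eps_pos.le
      rw [← hg, ← hgg, ← hD, ← hX] at h1
      have h2 := abs_le.1 (h.abs_dot_centered_le ha (toReal q))
      rw [← hg, ← hL, ← hX] at h2
      have hgz : 2 * g * (X / g - η + D / (2 * g)) = 2 * X - 2 * ε * δ * g + D := by
        rw [hη]; field_simp
      have h3 : toReal (nextQueue q s a) ⬝ᵥ toReal (nextQueue q s a) ≤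
          g * g + 2 * g * (X / g - η + D / (2 * g)) := by
        rw [hgz]; linarith
      have hX1 : X / g ≤ L := by rw [div_le_iff₀ hgpos]; linarith
      have hX2 : -L ≤ X / g := by rw [le_div_iff₀ hgpos]; linarith
      have hD1 : D / (2 * g) ≤ D := div_le_self hD0 (by linarith)
      have hD2 : 0 ≤ D / (2 * g) := by positivity
      -- `z = X / g - η + D / (2g)` is the norm increment to first order: centered noise, drift
      -- `-η`, and a correction that is at most `η / 4` for large `g`.
      have hzc : |X / g - η + D / (2 * g)| ≤ c := by
        rw [abs_le]; constructor <;> linarith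
      refine (exp_mul_sqrt_le hθ hgpos (dot_self_nonneg _) h3 hzc hθc).trans_eq ?_
      rw [← hk]; ring)
  rw [h.integral_centered] at hmain
  refine hmain.trans ?_
  rw [mul_comm _ k]
  refine mul_le_mul_of_nonneg_left ?_ hk0.le
  have h1 : D / (2 * g) ≤ η / 4 := by
    rw [div_le_iff₀ (by linarith)]
    linarith
  have h2 := mul_le_mul_of_nonneg_left h1 hθ.le
  have h3 : θ ^ 2 * c ^ 2 = θ * (η / 4) := by rw [← hθc2]; ring
  rw [h3]
  linarith

/-- The exponential of a small multiple of the Euclidean norm has geometric drift. -/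
theorem exists_geometric_drift (h : S.IsLoaded A ν δ ε) :
    ∃ θ > 0, ∃ γ, 0 ≤ γ ∧ γ < 1 ∧ ∃ K > 0, ∀ q : Vec N,
      ∫ z, Real.exp (θ * √(toReal z ⬝ᵥ toReal z)) ∂S.transition q ≤
        γ * Real.exp (θ * √(toReal q ⬝ᵥ toReal q)) + K := by
  set η := ε * δ with hη
  have hη0 : 0 < η := mul_pos h.eps_pos h.delta_pos
  have hη1 : η ≤ 1 := mul_le_one₀ h.eps_lt.le h.delta_pos.le h.delta_le_one
  set c : ℝ := N * N * (A + 1) + 1 + N * N * (A + 1) ^ 2 with hc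
  have hc1 : 1 ≤ c := by
    have h1 : (0 : ℝ) ≤ N * N * (A + 1) := by positivity
    have h2 : (0 : ℝ) ≤ N * N * (A + 1) ^ 2 := by positivity
    linarith
  -- Beyond norm `G` the correction is at most `η / 4`. The choice of `θ` makes the quadratic term
  -- of the exponential `θη / 4` as well, which leaves half of the drift `-θη`.
  set G : ℝ := 1 + 2 * (N * N * (A + 1) ^ 2) / η with hG
  have hG1 : 1 ≤ G := le_add_of_nonneg_right (by positivity)
  have hGD : 2 * (N * N * (A + 1) ^ 2) ≤ η * G := by
    rw [hG, mul_add, mul_div_cancel₀ _ hη0.ne']; linarith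
  set θ := η / (4 * c ^ 2) with hθ
  have hθ0 : 0 < θ := by positivity
  have hθc2 : θ * c ^ 2 = η / 4 := by rw [hθ]; field_simp
  have hcc : c ≤ c ^ 2 := by rw [sq]; exact le_mul_of_one_le_left (by linarith) hc1
  have hθc : θ * c ≤ 1 := by
    have := mul_le_mul_of_nonneg_left hcc hθ0.le
    linarith
  have hθ1 : θ ≤ 1 := (le_mul_of_one_le_right hθ0.le hc1).trans hθc
  have hθη : θ * η ≤ 1 := mul_le_one₀ hθ1 hη0.le hη1
  have hγ : 0 ≤ 1 - θ * η / 2 := by linarith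
  refine ⟨θ, hθ0, 1 - θ * η / 2, hγ, by linarith [mul_pos hθ0 hη0],
    _, Real.exp_pos (θ * (G + N * N * (A + 1) + N * N * (A + 1) ^ 2)), fun q => ?_⟩
  by_cases hgG : √(toReal q ⬝ᵥ toReal q) < G
  · exact (h.integral_exp_le_of_lt hθ0 hG1 hgG).trans
      (le_add_of_nonneg_left (mul_nonneg hγ (Real.exp_pos _).le))
  · push Not at hgG
    exact (h.integral_exp_le_of_ge hθ0 hc.ge hθc hθc2 (hG1.trans hgG)
      (hGD.trans (mul_le_mul_of_nonneg_left hgG hη0.le))).trans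
      (le_add_of_nonneg_right (Real.exp_pos _).le)

theorem finite_sublevel {θ : ℝ} (hθ : 0 < θ) (R : ℝ) :
    {q : Vec N | Real.exp (θ * √(toReal q ⬝ᵥ toReal q)) ≤ R}.Finite := by
  refine (bounded_arrivals_finite ⌊R / θ⌋₊).subset fun q hq p => ?_
  have h1 : (q p : ℝ) ≤ √(toReal q ⬝ᵥ toReal q) :=
    (le_abs_self _).trans (abs_le_sqrt_dot_self (toReal q) p)
  have h2 := (Real.add_one_le_exp (θ * √(toReal q ⬝ᵥ toReal q))).trans hq
  refine Nat.le_floor ?_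
  rw [le_div_iff₀ hθ]
  nlinarith

/-- Existence and uniqueness of the steady state. -/
theorem existsUnique_isSteadyState (h : S.IsLoaded A ν δ ε) : ∃! π, S.IsSteadyState π := by
  obtain ⟨θ, hθ, γ, hγ0, hγ1, K, hK, hdrift⟩ := h.exists_geometric_drift
  have h0 : (S.arrival : Measure (Vec N)) {0} ≠ 0 := by
    refine arrival_zero_ne_zero h.bdd h.indep fun p => ?_
    rw [h.mean]
    have h1 := h.rate_le_one p
    have h2 := h.delta_pos.trans_le (h.delta_le p)
    nlinarith [h.eps_pos, h.eps_lt]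
  obtain ⟨π, hinv, hπ⟩ := (finitelySupported h.bdd).exists_invariant_tendsto
    (fun q => (Real.exp_pos _).le) (finite_sublevel hθ) hγ0 hγ1 hK hdrift
    (transition_zero_zero_ne_zero h0) (exists_pow_transition_zero_ne_zero h0)
  exact ⟨π, ⟨hinv, hπ⟩, fun π' hπ' => tendsto_nhds_unique (hπ'.tendsto 0) (hπ 0)⟩

/-- Functions of polynomial growth are integrable in steady state. -/
theorem integrable_of_le (h : S.IsLoaded A ν δ ε) {π : ProbabilityMeasure (Vec N)}
    (hπ : S.IsSteadyState π) {φ : Vec N → ℝ} {C : ℝ}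
    (hφ : ∀ q, |φ q| ≤ C * (1 + toReal q ⬝ᵥ toReal q) ^ 2) : Integrable φ (π : Measure (Vec N)) := by
  obtain ⟨θ, hθ, γ, hγ0, hγ1, K, hK, hdrift⟩ := h.exists_geometric_drift
  have hfs := finitelySupported h.bdd
  have hV : Integrable (fun q : Vec N => Real.exp (θ * √(toReal q ⬝ᵥ toReal q)))
      (π : Measure (Vec N)) := by
    refine integrable_of_tendsto_of_integral_le (hπ.tendsto 0) (fun q => (Real.exp_pos _).le)
      (fun n => (hfs.pow n).integrable _ _)
      (c := Real.exp (θ * √(toReal (0 : Vec N) ⬝ᵥ toReal 0)) + K / (1 - γ)) fun n => ?_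
    refine (hfs.integral_pow_le hγ0 hγ1 hdrift n 0).trans ?_
    have h1 : γ ^ n ≤ 1 := pow_le_one₀ hγ0 hγ1.le
    have h2 : 0 ≤ γ ^ n := pow_nonneg hγ0 n
    have h3 : 0 < 1 - γ := by linarith
    refine add_le_add ?_ ?_
    · exact mul_le_of_le_one_left (Real.exp_pos _).le h1
    · gcongr; nlinarith
  have hC : 0 ≤ C := by
    have := (abs_nonneg _).trans (hφ 0)
    have h1 : toReal (0 : Vec N) = 0 := by ext; simp [toReal]
    simpa [h1] using this
  refine (hV.const_mul (C * (2 + 48 / θ ^ 4))).mono' Measurable.of_discrete.aestronglyMeasurable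
    (Eventually.of_forall fun q => (hφ q).trans ?_)
  rw [mul_assoc]
  refine mul_le_mul_of_nonneg_left ?_ hC
  set g := √(toReal q ⬝ᵥ toReal q) with hg
  have hg0 : 0 ≤ g := Real.sqrt_nonneg _
  have hgg : g * g = toReal q ⬝ᵥ toReal q := Real.mul_self_sqrt (dot_self_nonneg _)
  -- The admitted growth is of degree four in the norm, so the fourth Taylor term of the exponential
  -- suffices.
  have h1 := Real.pow_div_factorial_le_exp (θ * g) (by positivity) 4
  have h2 : (1 : ℝ) ≤ Real.exp (θ * g) := Real.one_le_exp (by positivity)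
  have h3 : g ^ 4 ≤ 24 / θ ^ 4 * Real.exp (θ * g) := by
    have : ((4 : ℕ).factorial : ℝ) = 24 := by norm_num [Nat.factorial]
    rw [this, div_le_iff₀ (by norm_num)] at h1
    rw [div_mul_eq_mul_div, le_div_iff₀ (by positivity)]
    calc g ^ 4 * θ ^ 4 = (θ * g) ^ 4 := by ring
      _ ≤ _ := by linarith
  rw [← hgg]
  have h4 : (1 + g * g) ^ 2 ≤ 2 + 2 * g ^ 4 := by nlinarith [sq_nonneg (g * g - 1)]
  have h5 : 48 / θ ^ 4 = 2 * (24 / θ ^ 4) := by ring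
  rw [h5]
  linarith

/-- The cubic term wins for large `t`. Here `t` is the distance to the cone and the left side is the
mean drift of its fourth power. -/
theorem exists_cubic_bound {δ D L : ℝ} (hδ : 0 < δ) (hD : 0 ≤ D) (hL : 0 ≤ L) :
    ∃ M : ℝ, ∀ t : ℝ, 0 ≤ t →
      -2 * δ * t ^ 3 + 2 * D * t ^ 2 + ((2 * L + 1) * t + D) ^ 2 ≤ -t ^ 2 + M := by
  set α := 2 * D + (2 * L + 1) ^ 2 + 1 with hα
  set β := 2 * (2 * L + 1) * D with hβ
  have hα0 : 0 ≤ α := by positivity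
  have hβ0 : 0 ≤ β := by positivity
  set T := (α + β) / (2 * δ) + 1 with hT
  have hT1 : 1 ≤ T := by
    have : 0 ≤ (α + β) / (2 * δ) := by positivity
    linarith
  have hTδ : α + β ≤ 2 * δ * T := by
    rw [hT, mul_add, mul_div_cancel₀ _ (by positivity)]; linarith
  refine ⟨α * T ^ 2 + β * T + D ^ 2, fun t ht => ?_⟩
  have key : -2 * δ * t ^ 3 + α * t ^ 2 + β * t ≤ α * T ^ 2 + β * T := by
    by_cases h : t ≤ T
    · have h1 : 0 ≤ 2 * δ * t ^ 3 := by positivity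
      have h2 : t ^ 2 ≤ T ^ 2 := pow_le_pow_left₀ ht h 2
      nlinarith [mul_le_mul_of_nonneg_left h2 hα0, mul_le_mul_of_nonneg_left h hβ0]
    · push Not at h
      have h1 : (α + β) * t ^ 2 ≤ 2 * δ * t * t ^ 2 := by
        refine mul_le_mul_of_nonneg_right ?_ (sq_nonneg t)
        nlinarith
      have h2 : β * t ≤ β * t ^ 2 := mul_le_mul_of_nonneg_left (by nlinarith) hβ0
      have h3 : 0 ≤ α * T ^ 2 + β * T := by positivity
      nlinarith
  nlinarith

/-- **State space collapse**: in steady state the squared distance to the cone has expectation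
bounded uniformly in the load. -/
theorem exists_perp_bound (N A : ℕ) {δ : ℝ} (hδ : 0 < δ) :
    ∃ M : ℝ, ∀ (S : MaxWeightSwitch N) (ν : Fin N × Fin N → ℝ) (ε : ℝ), S.IsLoaded A ν δ ε →
      2 * N * ε ≤ δ → ∀ π : ProbabilityMeasure (Vec N), S.IsSteadyState π →
      ∫ q, perp (toReal q) ⬝ᵥ perp (toReal q) ∂(π : Measure (Vec N)) ≤ M := by
  set L : ℝ := N * N * (A + 1) with hL
  set D : ℝ := N * N * (A + 1) ^ 2 with hD
  have hL0 : 0 ≤ L := by positivity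
  have hD0 : 0 ≤ D := by positivity
  obtain ⟨M, hM⟩ := exists_cubic_bound hδ hD0 hL0
  refine ⟨M, fun S ν ε h hsmall π hπ => ?_⟩
  have hδ1 := h.delta_le_one
  set w : Vec N → ℝ := fun q => perp (toReal q) ⬝ᵥ perp (toReal q) with hw
  have hw0 : ∀ q, 0 ≤ w q := fun q => dot_self_nonneg _
  have hwle : ∀ q, w q ≤ toReal q ⬝ᵥ toReal q := fun q => perp_dot_self_le _
  have hi1 : Integrable w (π : Measure (Vec N)) := h.integrable_of_le hπ (C := 1) fun q => by
    rw [abs_of_nonneg (hw0 q)]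
    nlinarith [hw0 q, hwle q]
  have hi2 : Integrable (fun q => w q ^ 2) (π : Measure (Vec N)) :=
    h.integrable_of_le hπ (C := 1) fun q => by
      rw [abs_of_nonneg (sq_nonneg _), one_mul]
      exact pow_le_pow_left₀ (hw0 q) (by linarith [hwle q]) 2
  -- The drift of `w` is only linear in the distance `f`. Squaring gives a drift of order `-f³`,
  -- which controls the mean of `w = f²` itself.
  have hdrift : ∀ q, ∫ z, w z ^ 2 ∂S.transition q ≤ w q ^ 2 - w q + M := by
    intro q
    set p := perp (toReal q) with hp
    set f := √(p ⬝ᵥ p) with hf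
    have hf0 : 0 ≤ f := Real.sqrt_nonneg _
    have hff : f * f = w q := Real.mul_self_sqrt (dot_self_nonneg _)
    have hmain := integral_transition_le (S := S) h.bdd (q := q) (φ := fun z => w z ^ 2)
      (χ := fun a => (f ^ 4 + -2 * δ * f ^ 3 + 2 * D * f ^ 2 + ((2 * L + 1) * f + D) ^ 2) +
        (4 * f ^ 2) * (p ⬝ᵥ (toReal a - (1 - ε) • ν))) (fun s hs a ha => by
        set X := p ⬝ᵥ (toReal a - (1 - ε) • ν) with hX
        have h1 := perp_dot_self_step_le hs ha hδ h.delta_le h.row h.col h.eps_pos.le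
        have h2 := abs_le.1 (h.abs_dot_centered_le ha p)
        rw [← hf, ← hL, ← hX] at h2
        have h3 : w (nextQueue q s a) ≤ f * f + (2 * X - δ * f + D) := by
          have e : f * f = p ⬝ᵥ p := hff
          -- Small load deficit, `2Nε ≤ δ`, leaves a restoring force independent of `ε`.
          have : δ * f ≤ 2 * (δ - ε * N) * f := mul_le_mul_of_nonneg_right (by linarith) hf0
          change perp (toReal (nextQueue q s a)) ⬝ᵥ perp (toReal (nextQueue q s a)) ≤ _
          rw [← hp, ← hf, ← hX, ← hD] at h1
          linarith
        have h4 : w (nextQueue q s a) ^ 2 ≤ (f * f + (2 * X - δ * f + D)) ^ 2 :=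
          pow_le_pow_left₀ (hw0 _) h3 2
        have h5 : |2 * X - δ * f + D| ≤ (2 * L + 1) * f + D := by
          have : δ * f ≤ f := mul_le_of_le_one_left hf0 hδ1
          have : 0 ≤ δ * f := by positivity
          rw [abs_le]; constructor <;> nlinarith
        have h6 : (2 * X - δ * f + D) ^ 2 ≤ ((2 * L + 1) * f + D) ^ 2 := by
          rw [← sq_abs]; exact pow_le_pow_left₀ (abs_nonneg _) h5 2
        refine h4.trans ?_
        nlinarith)
    rw [h.integral_centered] at hmain
    have h1 := hM f hf0
    have e1 : f ^ 4 = w q ^ 2 := by rw [← hff]; ring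
    have e2 : f ^ 2 = w q := by rw [← hff]; ring
    linarith
  obtain ⟨hi3, heq⟩ := integral_integral_of_invariant hπ.invariant hi2
  have hi4 : Integrable (fun q => w q ^ 2 - w q) (π : Measure (Vec N)) := hi2.sub hi1
  have hi5 : Integrable (fun q => w q ^ 2 - w q + M) (π : Measure (Vec N)) :=
    hi4.add (integrable_const M)
  have h1 := integral_mono hi3 hi5 hdrift
  rw [heq, integral_add hi4 (integrable_const M), integral_sub hi2 hi1] at h1
  simp only [integral_const, probReal_univ, one_smul] at h1
  linarith

end IsLoaded
end MaxWeightSwitch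
-- Lost service and the quadratic test function.
/-- MaxWeight leaves an input and an output simultaneously unmatched only if the queue between
them is empty. -/
theorem queue_eq_zero_of_unmatched {q s : Vec N} (hs : s ∈ maxWeightSchedules q) {i j : Fin N}
    (hi : ∑ j', s (i, j') = 0) (hj : ∑ i', s (i', j) = 0) : q (i, j) = 0 := by
  classical
  have hsi : ∀ j', s (i, j') = 0 := fun j' => Finset.sum_eq_zero_iff.1 hi j' (Finset.mem_univ _)
  have hsj : ∀ i', s (i', j) = 0 := fun i' => Finset.sum_eq_zero_iff.1 hj i' (Finset.mem_univ _)
  have h1 := single_mem_feasible (i, j)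
  -- Matching the two free ports is feasible and raises the weight by `q (i, j)`, which optimality
  -- forces to be zero.
  have hf : s + Pi.single (i, j) 1 ∈ feasible N := by
    refine ⟨fun p => ?_, fun i' => ?_, fun j' => ?_⟩
    · by_cases hp : p = (i, j)
      · subst hp; right; simp [hsi]
      · simpa [hp] using hs.1.1 p
    · by_cases h : i' = i
      · subst h
        simpa [hsi] using h1.2.1 i'
      · have := hs.1.2.1 i'
        simpa [Pi.single_apply, h] using this
    · by_cases h : j' = j
      · subst h
        simpa [hsj] using h1.2.2 j'
      · have := hs.1.2.2 j'
        simpa [Pi.single_apply, h] using this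
  have h2 := hs.2 _ hf
  have h3 : weight q (s + Pi.single (i, j) 1) = weight q s + q (i, j) := by
    simp [weight, mul_add, Finset.sum_add_distrib, Pi.single_apply]
  omega

/-- The service lost in one slot, including the unused service and the service of unmatched
ports. -/
theorem exists_lost_service {q s a : Vec N} {A : ℕ} (hs : s ∈ maxWeightSchedules q)
    (ha : ∀ p, a p ≤ A) :
    ∃ d : Fin N × Fin N → ℝ, (∀ p, 0 ≤ d p) ∧
      (∀ p, d p * toReal (nextQueue q s a) p ≤ A * d p) ∧
      (∀ i, ∑ j, toReal (nextQueue q s a) (i, j) =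
        ∑ j, toReal q (i, j) + (∑ j, toReal a (i, j) - 1) + ∑ j, d (i, j)) ∧
      (∀ j, ∑ i, toReal (nextQueue q s a) (i, j) =
        ∑ i, toReal q (i, j) + (∑ i, toReal a (i, j) - 1) + ∑ i, d (i, j)) ∧
      ∀ i, ∑ j, d (i, j) ≤ 1 := by
  set r : Fin N → ℝ := fun i => 1 - ∑ j, toReal s (i, j) with hr
  set c : Fin N → ℝ := fun j => 1 - ∑ i, toReal s (i, j) with hc
  have hr0 : ∀ i, 0 ≤ r i := fun i => by
    simp only [hr, toReal, sub_nonneg]; exact_mod_cast hs.1.2.1 i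
  have hc0 : ∀ j, 0 ≤ c j := fun j => by
    simp only [hc, toReal, sub_nonneg]; exact_mod_cast hs.1.2.2 j
  have hrc : ∑ i, r i = ∑ j, c j := by
    simp only [hr, hc, Finset.sum_sub_distrib]
    rw [Finset.sum_comm]
  have hnext := toReal_nextQueue (q := q) (a := a) hs.1
  -- The slack is spread over pairs of an unmatched input and an unmatched output. Their queues are
  -- empty before the slot, hence at most `A` after it.
  refine ⟨unused q s a + fill r c, fun p => add_nonneg (unused_nonneg p) (fill_nonneg hr0 hc0 p),
    fun p => ?_, fun i => ?_, fun j => ?_, fun i => ?_⟩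
  · have h1 := unused_mul_nextQueue (q := q) (s := s) (a := a) p
    have h2 : fill r c p * toReal (nextQueue q s a) p ≤ A * fill r c p := by
      by_cases h0 : fill r c p = 0
      · simp [h0]
      · have h3 : r p.1 ≠ 0 ∧ c p.2 ≠ 0 := by
          constructor <;> intro hz <;> exact h0 (by simp [fill, hz])
        have h4 : ∑ j, s (p.1, j) = 0 := by
          by_contra hne
          have h5 : ∑ j, s (p.1, j) = 1 := by have := hs.1.2.1 p.1; omega
          refine h3.1 ?_
          simp only [hr, toReal, sub_eq_zero]
          exact_mod_cast h5.symm
        have h5 : ∑ i, s (i, p.2) = 0 := by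
          by_contra hne
          have h5 : ∑ i, s (i, p.2) = 1 := by have := hs.1.2.2 p.2; omega
          refine h3.2 ?_
          simp only [hc, toReal, sub_eq_zero]
          exact_mod_cast h5.symm
        have h6 : q p = 0 := queue_eq_zero_of_unmatched hs h4 h5
        have h7 : toReal (nextQueue q s a) p ≤ A := by
          have h8 := ha p
          have : nextQueue q s a p ≤ A := by simp only [nextQueue]; omega
          exact Nat.cast_le.2 this
        rw [mul_comm]
        exact mul_le_mul_of_nonneg_right h7 (fill_nonneg hr0 hc0 p)
    have h3 : 0 ≤ (A : ℝ) * unused q s a p := mul_nonneg (Nat.cast_nonneg _) (unused_nonneg p)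
    simp only [Pi.add_apply, add_mul, mul_add, h1]
    linarith
  · simp only [hnext, Pi.add_apply, Pi.sub_apply, Finset.sum_add_distrib, Finset.sum_sub_distrib,
      sum_fill_row hr0 hrc]
    simp only [hr]; ring
  · simp only [hnext, Pi.add_apply, Pi.sub_apply, Finset.sum_add_distrib, Finset.sum_sub_distrib,
      sum_fill_col hc0 hrc]
    simp only [hc]; ring
  · simp only [Pi.add_apply, Finset.sum_add_distrib, sum_fill_row hr0 hrc]
    simp only [hr]
    have : ∑ j, unused q s a (i, j) ≤ ∑ j, toReal s (i, j) :=
      Finset.sum_le_sum fun j _ => unused_le _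
    linarith

/-- `N ^ 2` times the projection onto the span of the indicators of rows and columns. -/
def parallel (x : Fin N × Fin N → ℝ) : Fin N × Fin N → ℝ := fun p =>
  N * ∑ j, x (p.1, j) + N * ∑ i, x (i, p.2) - ∑ r, x r

/-- `N ^ 2` times the squared norm of the projection onto the span of the indicators of rows and
columns. -/
def parallelNormSq (x : Fin N × Fin N → ℝ) : ℝ :=
  N * (∑ i, (∑ j, x (i, j)) ^ 2 + ∑ j, (∑ i, x (i, j)) ^ 2) - (∑ p, x p) ^ 2

theorem sum_eq_sum_rows (x : Fin N × Fin N → ℝ) : ∑ p, x p = ∑ i, ∑ j, x (i, j) :=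
  Fintype.sum_prod_type _

theorem sum_eq_sum_cols (x : Fin N × Fin N → ℝ) : ∑ p, x p = ∑ j, ∑ i, x (i, j) := by
  rw [sum_eq_sum_rows, Finset.sum_comm]

theorem dot_parallel (x y : Fin N × Fin N → ℝ) :
    x ⬝ᵥ parallel y = N * ∑ i, (∑ j, x (i, j)) * (∑ j, y (i, j)) +
      N * ∑ j, (∑ i, x (i, j)) * (∑ i, y (i, j)) - (∑ p, x p) * ∑ p, y p := by
  have h1 : ∑ p : Fin N × Fin N, x p * ∑ j, y (p.1, j) =
      ∑ i, (∑ j, x (i, j)) * (∑ j, y (i, j)) := by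
    rw [sum_eq_sum_rows]
    exact Finset.sum_congr rfl fun i _ => by rw [Finset.sum_mul]
  have h2 : ∑ p : Fin N × Fin N, x p * ∑ i, y (i, p.2) =
      ∑ j, (∑ i, x (i, j)) * (∑ i, y (i, j)) := by
    rw [sum_eq_sum_cols]
    exact Finset.sum_congr rfl fun i _ => by rw [Finset.sum_mul]
  rw [← h1, ← h2, Finset.mul_sum, Finset.mul_sum, Finset.sum_mul, ← Finset.sum_add_distrib,
    ← Finset.sum_sub_distrib]
  exact Finset.sum_congr rfl fun p _ => by simp only [parallel]; ring

theorem sum_parallel_row (x : Fin N × Fin N → ℝ) (i : Fin N) :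
    ∑ j, parallel x (i, j) = N ^ 2 * ∑ j, x (i, j) := by
  simp only [parallel, Finset.sum_sub_distrib, Finset.sum_add_distrib, ← Finset.mul_sum,
    ← sum_eq_sum_cols, Finset.sum_const, Finset.card_univ, Fintype.card_fin, nsmul_eq_mul]
  ring

theorem sum_parallel_col (x : Fin N × Fin N → ℝ) (j : Fin N) :
    ∑ i, parallel x (i, j) = N ^ 2 * ∑ i, x (i, j) := by
  simp only [parallel, Finset.sum_sub_distrib, Finset.sum_add_distrib, ← Finset.mul_sum,
    ← sum_eq_sum_rows, Finset.sum_const, Finset.card_univ, Fintype.card_fin, nsmul_eq_mul]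
  ring

/-- The pairing of a nonnegative matrix with the projection of `y` is controlled by its pairing
with `y` and the distance of `y` to the cone. -/
theorem abs_dot_parallel_le (hN : 1 ≤ N) {d y : Fin N × Fin N → ℝ} {A : ℝ} (hA : 0 ≤ A)
    (hd : ∀ p, 0 ≤ d p) (hy : ∀ p, 0 ≤ y p) (hdy : ∀ p, d p * y p ≤ A * d p) :
    |d ⬝ᵥ parallel y| ≤ N ^ 2 * ((∑ p, d p) * (A + √(perp y ⬝ᵥ perp y))) := by
  have hN0 : (0 : ℝ) < N ^ 2 := by
    have : (0 : ℝ) < N := by exact_mod_cast hN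
    positivity
  set f := √(perp y ⬝ᵥ perp y) with hf
  have hf0 : 0 ≤ f := Real.sqrt_nonneg _
  -- The residual `e` has zero row and column sums, so it lies in the polar cone and its norm is at
  -- most the distance of `y` to the cone. Then `parallel y = N²(y - e)` splits the pairing.
  set e : Fin N × Fin N → ℝ := y - ((N : ℝ) ^ 2)⁻¹ • parallel y with he
  have hrow : ∀ i, ∑ j, e (i, j) = 0 := by
    intro i
    simp only [he, Pi.sub_apply, Pi.smul_apply, smul_eq_mul, Finset.sum_sub_distrib,
      ← Finset.mul_sum, sum_parallel_row]
    field_simp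
    ring
  have hcol : ∀ j, ∑ i, e (i, j) = 0 := by
    intro j
    simp only [he, Pi.sub_apply, Pi.smul_apply, smul_eq_mul, Finset.sum_sub_distrib,
      ← Finset.mul_sum, sum_parallel_col]
    field_simp
    ring
  have hepar : e ⬝ᵥ parallel y = 0 := by
    rw [dot_parallel, sum_eq_sum_rows e]
    simp [hrow, hcol]
  have hee : e ⬝ᵥ e = y ⬝ᵥ e := by
    conv_lhs => rw [he, ← he]
    nth_rewrite 2 [he]
    rw [dotProduct_sub, dotProduct_smul, hepar, dotProduct_comm]
    simp
  have hle := dot_self_le_perp (x := y) (y := e) ⟨fun i => (hrow i).le, fun j => (hcol j).le⟩ hee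
  have hef : ∀ p, |e p| ≤ f := fun p =>
    (abs_le_sqrt_dot_self e p).trans (Real.sqrt_le_sqrt hle)
  have hpar : parallel y = ((N : ℝ) ^ 2) • (y - e) := by
    rw [he, sub_sub_cancel, smul_smul, mul_inv_cancel₀ hN0.ne', one_smul]
  rw [hpar, dotProduct_smul, smul_eq_mul, abs_mul, abs_of_pos hN0]
  refine mul_le_mul_of_nonneg_left ?_ hN0.le
  refine (Finset.abs_sum_le_sum_abs _ _).trans ?_
  rw [Finset.sum_mul]
  refine Finset.sum_le_sum fun p _ => ?_
  have h1 : 0 ≤ d p * y p := mul_nonneg (hd p) (hy p)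
  have h2 := abs_le.1 (hef p)
  have h3 := hdy p
  have h4 : d p * e p ≤ d p * f := mul_le_mul_of_nonneg_left h2.2 (hd p)
  have h5 : d p * (-f) ≤ d p * e p := mul_le_mul_of_nonneg_left h2.1 (hd p)
  have h6 : 0 ≤ A * d p := mul_nonneg hA (hd p)
  simp only [Pi.sub_apply]
  rw [abs_le]
  constructor <;> linarith

/-- The drift, without the lost service, of `parallelNormSq`. -/
def freeDrift (x α : Fin N × Fin N → ℝ) : ℝ :=
  2 * (parallel x ⬝ᵥ α) - 2 * N * ∑ p, x p +
    (N * (∑ i, (∑ j, α (i, j) - 1) ^ 2 + ∑ j, (∑ i, α (i, j) - 1) ^ 2) - (∑ p, α p - N) ^ 2)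

/-- One-step expansion of `parallelNormSq` in terms of the lost service `d`. -/
theorem parallelNormSq_step_eq {x y α d : Fin N × Fin N → ℝ}
    (hrow : ∀ i, ∑ j, y (i, j) = ∑ j, x (i, j) + (∑ j, α (i, j) - 1) + ∑ j, d (i, j))
    (hcol : ∀ j, ∑ i, y (i, j) = ∑ i, x (i, j) + (∑ i, α (i, j) - 1) + ∑ i, d (i, j))
    (htot : ∑ p, y p = ∑ p, x p + (∑ p, α p - N) + ∑ p, d p) :
    parallelNormSq y - (parallelNormSq x + freeDrift x α) =
      2 * (d ⬝ᵥ parallel y) -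
        (N * (∑ i, (∑ j, d (i, j)) ^ 2 + ∑ j, (∑ i, d (i, j)) ^ 2) - (∑ p, d p) ^ 2) := by
  -- Expanding `(y - d)²` rather than `(x + α - 1 + d)²` pairs `d` with the new vector `y`, which is
  -- small where `d` is positive.
  have hrows : ∑ i, (∑ j, y (i, j)) ^ 2 = ∑ i, (∑ j, x (i, j)) ^ 2 +
      2 * ∑ i, (∑ j, α (i, j)) * (∑ j, x (i, j)) - 2 * ∑ p, x p +
      ∑ i, (∑ j, α (i, j) - 1) ^ 2 + 2 * ∑ i, (∑ j, d (i, j)) * (∑ j, y (i, j)) -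
      ∑ i, (∑ j, d (i, j)) ^ 2 := by
    rw [sum_eq_sum_rows x]
    simp only [Finset.mul_sum (a := (2 : ℝ)), ← Finset.sum_add_distrib, ← Finset.sum_sub_distrib]
    refine Finset.sum_congr rfl fun i _ => ?_
    rw [← Finset.mul_sum, hrow]; ring
  have hcols : ∑ j, (∑ i, y (i, j)) ^ 2 = ∑ j, (∑ i, x (i, j)) ^ 2 +
      2 * ∑ j, (∑ i, α (i, j)) * (∑ i, x (i, j)) - 2 * ∑ p, x p +
      ∑ j, (∑ i, α (i, j) - 1) ^ 2 + 2 * ∑ j, (∑ i, d (i, j)) * (∑ i, y (i, j)) -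
      ∑ j, (∑ i, d (i, j)) ^ 2 := by
    rw [sum_eq_sum_cols x]
    simp only [Finset.mul_sum (a := (2 : ℝ)), ← Finset.sum_add_distrib, ← Finset.sum_sub_distrib]
    refine Finset.sum_congr rfl fun j _ => ?_
    rw [← Finset.mul_sum, hcol]; ring
  rw [freeDrift, dotProduct_comm, dot_parallel, dot_parallel, parallelNormSq, parallelNormSq,
    hrows, hcols, htot]
  ring

/-- The second-order terms in the lost service are of the order of the total lost service. -/
theorem abs_lost_quadratic_le (hN : 1 ≤ N) {d : Fin N × Fin N → ℝ} (hd0 : ∀ p, 0 ≤ d p)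
    (hd : ∑ p, d p ≤ N) :
    |N * (∑ i, (∑ j, d (i, j)) ^ 2 + ∑ j, (∑ i, d (i, j)) ^ 2) - (∑ p, d p) ^ 2| ≤
      2 * N ^ 2 * ∑ p, d p := by
  have hN1 : (1 : ℝ) ≤ N := by exact_mod_cast hN
  have hb2 : ∑ i, (∑ j, d (i, j)) ^ 2 ≤ (∑ p, d p) ^ 2 := by
    rw [sum_eq_sum_rows]
    exact Finset.sum_sq_le_sq_sum_of_nonneg fun i _ => Finset.sum_nonneg fun j _ => hd0 _
  have hc2 : ∑ j, (∑ i, d (i, j)) ^ 2 ≤ (∑ p, d p) ^ 2 := by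
    rw [sum_eq_sum_cols]
    exact Finset.sum_sq_le_sq_sum_of_nonneg fun i _ => Finset.sum_nonneg fun j _ => hd0 _
  have hb0 : 0 ≤ ∑ i, (∑ j, d (i, j)) ^ 2 := Finset.sum_nonneg fun i _ => sq_nonneg _
  have hc0 : 0 ≤ ∑ j, (∑ i, d (i, j)) ^ 2 := Finset.sum_nonneg fun i _ => sq_nonneg _
  have hB0 : 0 ≤ ∑ p, d p := Finset.sum_nonneg fun p _ => hd0 p
  generalize ∑ i, (∑ j, d (i, j)) ^ 2 = u at *
  generalize ∑ j, (∑ i, d (i, j)) ^ 2 = v at *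
  generalize ∑ p, d p = B at *
  have hBB : B ^ 2 ≤ N * B := by rw [sq]; exact mul_le_mul_of_nonneg_right hd hB0
  have h1 : (N : ℝ) * (u + v) ≤ N * (2 * (N * B)) :=
    mul_le_mul_of_nonneg_left (by linarith) (by linarith)
  have h2 : 0 ≤ (N : ℝ) * (u + v) := mul_nonneg (by linarith) (by linarith)
  have h3 : (N : ℝ) * B ≤ N * (N * B) :=
    le_mul_of_one_le_left (mul_nonneg (by linarith) hB0) hN1
  have h4 := sq_nonneg B
  have h5 : 0 ≤ (N : ℝ) * (N * B) := by positivity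
  have h6 : 2 * (N : ℝ) ^ 2 * B = 2 * (N * (N * B)) := by ring
  rw [h6, abs_le]
  constructor <;> linarith

/-- One-step expansion of `parallelNormSq`, up to an error controlled by the lost service and the
distance to the cone. -/
theorem abs_parallelNormSq_step_le (hN : 1 ≤ N) {q s a : Vec N} {A : ℕ}
    (hs : s ∈ maxWeightSchedules q) (ha : ∀ p, a p ≤ A) {η : ℝ} (hη : 0 < η) :
    |parallelNormSq (toReal (nextQueue q s a)) -
        (parallelNormSq (toReal q) + freeDrift (toReal q) (toReal a))| ≤
      (2 * N ^ 2 * (A + 1) + N ^ 3 / η) * (∑ p, toReal (nextQueue q s a) p -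
          ∑ p, toReal q p - ∑ p, toReal a p + N) +
        N ^ 2 * η * (perp (toReal (nextQueue q s a)) ⬝ᵥ perp (toReal (nextQueue q s a))) := by
  obtain ⟨d, hd0, hdy, hrow, hcol, hd1⟩ := exists_lost_service hs ha
  have hy0 : ∀ p, 0 ≤ toReal (nextQueue q s a) p := fun p => Nat.cast_nonneg _
  generalize toReal (nextQueue q s a) = y at *
  generalize toReal q = x at *
  generalize toReal a = α at *
  have htot : ∑ p, y p = ∑ p, x p + (∑ p, α p - N) + ∑ p, d p := by
    rw [sum_eq_sum_rows y, sum_eq_sum_rows x, sum_eq_sum_rows α, sum_eq_sum_rows d]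
    simp only [hrow, Finset.sum_add_distrib, Finset.sum_sub_distrib]
    simp
  have hBN : ∑ p, d p ≤ N := by
    rw [sum_eq_sum_rows]
    calc ∑ i, ∑ j, d (i, j) ≤ ∑ _i : Fin N, (1 : ℝ) := Finset.sum_le_sum fun i _ => hd1 i
      _ = N := by simp
  have hBeq : ∑ p, y p - ∑ p, x p - ∑ p, α p + N = ∑ p, d p := by linarith
  have hquad := abs_lost_quadratic_le hN hd0 hBN
  have hpar := abs_dot_parallel_le hN (Nat.cast_nonneg A) hd0 hy0 hdy
  have hB0 : 0 ≤ ∑ p, d p := Finset.sum_nonneg fun p _ => hd0 p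
  have hff := Real.mul_self_sqrt (dot_self_nonneg (perp y))
  rw [hBeq, parallelNormSq_step_eq hrow hcol htot, ← hff]
  refine (abs_sub _ _).trans ?_
  rw [abs_mul, abs_two]
  generalize √(perp y ⬝ᵥ perp y) = f at *
  generalize ∑ p, d p = B at *
  have hBB : B ^ 2 ≤ N * B := by rw [sq]; exact mul_le_mul_of_nonneg_right hBN hB0
  -- Weighted AM-GM, with `B² ≤ N B` replacing the square of the lost service by its first power,
  -- whose stationary mean is known.
  have hBf : 2 * (B * f) ≤ N / η * B + η * (f * f) := by
    have h1 : 0 ≤ (B - η * f) ^ 2 := sq_nonneg _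
    have h2 : 2 * (B * f) * η ≤ N * B + η * η * (f * f) := by linarith
    rw [← mul_le_mul_iff_of_pos_right hη]
    refine h2.trans_eq ?_
    field_simp
  have h7 := mul_le_mul_of_nonneg_left hBf (show (0 : ℝ) ≤ N ^ 2 by positivity)
  calc _ ≤ 2 * (N ^ 2 * (B * (A + f))) + 2 * N ^ 2 * B := by linarith
    _ = 2 * N ^ 2 * (A + 1) * B + N ^ 2 * (2 * (B * f)) := by ring
    _ ≤ 2 * N ^ 2 * (A + 1) * B + N ^ 2 * (N / η * B + η * (f * f)) := by linarith
    _ = _ := by ring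

theorem sum_toReal_nonneg (q : Vec N) : 0 ≤ ∑ p, toReal q p :=
  Finset.sum_nonneg fun _ _ => Nat.cast_nonneg _

theorem sq_sum_toReal_le (q : Vec N) :
    (∑ p, toReal q p) ^ 2 ≤ N ^ 2 * (toReal q ⬝ᵥ toReal q) := by
  refine sq_sum_le_card_mul_sum_sq.trans_eq ?_
  simp [dotProduct, sq]

theorem abs_parallelNormSq_le (q : Vec N) :
    |parallelNormSq (toReal q)| ≤ (2 * N + 1) * N ^ 2 * (toReal q ⬝ᵥ toReal q) := by
  set x := toReal q with hx
  have hx0 : ∀ p, 0 ≤ x p := fun p => Nat.cast_nonneg _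
  have h1 : ∑ i, (∑ j, x (i, j)) ^ 2 ≤ (∑ p, x p) ^ 2 := by
    rw [sum_eq_sum_rows]
    exact Finset.sum_sq_le_sq_sum_of_nonneg fun i _ => Finset.sum_nonneg fun j _ => hx0 _
  have h2 : ∑ j, (∑ i, x (i, j)) ^ 2 ≤ (∑ p, x p) ^ 2 := by
    rw [sum_eq_sum_cols]
    exact Finset.sum_sq_le_sq_sum_of_nonneg fun i _ => Finset.sum_nonneg fun j _ => hx0 _
  have h3 : 0 ≤ ∑ i, (∑ j, x (i, j)) ^ 2 := Finset.sum_nonneg fun i _ => sq_nonneg _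
  have h4 : 0 ≤ ∑ j, (∑ i, x (i, j)) ^ 2 := Finset.sum_nonneg fun i _ => sq_nonneg _
  have h5 := sq_sum_toReal_le q
  rw [← hx] at h5
  have hN : (0 : ℝ) ≤ N := Nat.cast_nonneg _
  have h6 := mul_le_mul_of_nonneg_left (add_le_add h1 h2) hN
  have h7 := mul_nonneg hN (add_nonneg h3 h4)
  have h8 := mul_le_mul_of_nonneg_left h5 (show (0 : ℝ) ≤ 2 * N + 1 by positivity)
  have h9 := sq_nonneg (∑ p, x p)
  have h10 := mul_nonneg hN h9
  rw [parallelNormSq, abs_le]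
  constructor <;> linarith

/-! ### Balance of the quadratic test function in steady state. -/

namespace MaxWeightSwitch

/-- The total variance of the arrivals. -/
noncomputable def totalVariance (S : MaxWeightSwitch N) : ℝ :=
  ∑ p, variance (fun a : Vec N => (a p : ℝ)) (S.arrival : Measure (Vec N))

namespace IsLoaded

variable {S : MaxWeightSwitch N} {A : ℕ} {ν : Fin N × Fin N → ℝ} {δ ε : ℝ}

theorem sum_rate (h : S.IsLoaded A ν δ ε) : ∑ p, ν p = N := by
  rw [sum_eq_sum_rows]; simp [h.row]

/-- By independence each variance is counted `N` times through its row, `N` times through its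
column, and subtracted once through the total. The means `1 - ε` of port sums leave `N²ε²`. -/
theorem integral_arrival_quadratic (h : S.IsLoaded A ν δ ε) :
    ∫ a, (N * (∑ i, (∑ j, toReal a (i, j) - 1) ^ 2 + ∑ j, (∑ i, toReal a (i, j) - 1) ^ 2) -
      (∑ p, toReal a p - N) ^ 2) ∂(S.arrival : Measure (Vec N)) =
    (2 * N - 1) * S.totalVariance + N ^ 2 * ε ^ 2 := by
  have hi := integrable_arrival h.bdd
  have hr : ∀ i : Fin N, ∫ a, (∑ j, toReal a (i, j) - 1) ^ 2 ∂(S.arrival : Measure (Vec N)) =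
      ∑ j, variance (fun a : Vec N => (a (i, j) : ℝ)) (S.arrival : Measure (Vec N)) + ε ^ 2 := by
    intro i
    have := integral_sq_sum_sub h.bdd h.indep (g := fun j : Fin N => (i, j))
      (Prod.mk_right_injective i) 1
    simp_rw [h.mean, ← Finset.mul_sum, h.row] at this
    simp only [toReal]
    rw [this]; ring
  have hc : ∀ j : Fin N, ∫ a, (∑ i, toReal a (i, j) - 1) ^ 2 ∂(S.arrival : Measure (Vec N)) =
      ∑ i, variance (fun a : Vec N => (a (i, j) : ℝ)) (S.arrival : Measure (Vec N)) + ε ^ 2 := by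
    intro j
    have := integral_sq_sum_sub h.bdd h.indep (g := fun i : Fin N => (i, j))
      (Prod.mk_left_injective j) 1
    simp_rw [h.mean, ← Finset.mul_sum, h.col] at this
    simp only [toReal]
    rw [this]; ring
  have ht : ∫ a, (∑ p, toReal a p - N) ^ 2 ∂(S.arrival : Measure (Vec N)) =
      S.totalVariance + N ^ 2 * ε ^ 2 := by
    have := integral_sq_sum_sub h.bdd h.indep (g := fun p : Fin N × Fin N => p)
      Function.injective_id N
    simp_rw [h.mean, ← Finset.mul_sum, h.sum_rate] at this
    simp only [toReal]
    rw [this, totalVariance]; ring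
  rw [integral_sub (hi _) (hi _), integral_const_mul, integral_add (hi _) (hi _),
    integral_finsetSum _ fun _ _ => hi _, integral_finsetSum _ fun _ _ => hi _, ht]
  simp_rw [hr, hc]
  have e1 : ∑ i, (∑ j, variance (fun a : Vec N => (a (i, j) : ℝ)) (S.arrival : Measure (Vec N))
      + ε ^ 2) = S.totalVariance + N * ε ^ 2 := by
    rw [Finset.sum_add_distrib, totalVariance, Fintype.sum_prod_type]; simp
  have e2 : ∑ j, (∑ i, variance (fun a : Vec N => (a (i, j) : ℝ)) (S.arrival : Measure (Vec N))
      + ε ^ 2) = S.totalVariance + N * ε ^ 2 := by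
    rw [Finset.sum_add_distrib, totalVariance, Fintype.sum_prod_type, Finset.sum_comm]; simp
  rw [e1, e2]; ring

/-- Integrated one-step expansion, with either sign. -/
theorem integral_parallelNormSq_le (h : S.IsLoaded A ν δ ε) {η : ℝ} (hη : 0 < η) {τ : ℝ}
    (hτ : |τ| = 1) (q : Vec N) :
    ∫ z, (τ * parallelNormSq (toReal z)
        - (2 * N ^ 2 * (A + 1) + N ^ 3 / η) * ∑ p, toReal z p
        - N ^ 2 * η * (perp (toReal z) ⬝ᵥ perp (toReal z))) ∂S.transition q ≤
      τ * (parallelNormSq (toReal q) - 2 * N * ε * ∑ p, toReal q p +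
        ((2 * N - 1) * S.totalVariance + N ^ 2 * ε ^ 2)) +
      (2 * N ^ 2 * (A + 1) + N ^ 3 / η) * (N * ε - ∑ p, toReal q p) := by
  set κ : ℝ := 2 * N ^ 2 * (A + 1) + N ^ 3 / η with hκ
  set x := toReal q with hx
  have hi := integrable_arrival h.bdd
  -- The total and distance terms in the test function absorb the error, which involves the new
  -- state. Total lost service equals the increment of the total queue, minus arrivals, plus `N`.
  refine (integral_transition_le h.bdd
    (χ := fun a => τ * (parallelNormSq x + freeDrift x (toReal a)) +
      κ * (N - ∑ p, x p - ∑ p, toReal a p)) fun s hs a ha => ?_).trans_eq ?_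
  · have h1 := abs_parallelNormSq_step_le h.size_pos hs ha hη
    rw [← hκ, ← hx] at h1
    have h2 : τ * (parallelNormSq (toReal (nextQueue q s a)) -
        (parallelNormSq x + freeDrift x (toReal a))) ≤
        |parallelNormSq (toReal (nextQueue q s a)) -
        (parallelNormSq x + freeDrift x (toReal a))| := by
      refine (le_abs_self _).trans_eq ?_
      rw [abs_mul, hτ, one_mul]
    linarith
  · set Q : Vec N → ℝ := fun a =>
      N * (∑ i, (∑ j, toReal a (i, j) - 1) ^ 2 + ∑ j, (∑ i, toReal a (i, j) - 1) ^ 2) -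
        (∑ p, toReal a p - N) ^ 2 with hQ
    have hpm : parallel x ⬝ᵥ ((1 - ε) • ν) = (1 - ε) * (N * ∑ p, x p) := by
      rw [dotProduct_smul, dotProduct_comm, dot_parallel, h.sum_rate, smul_eq_mul]
      simp only [h.row, h.col, one_mul, ← sum_eq_sum_rows, ← sum_eq_sum_cols]
      ring
    have h1m : (1 : Fin N × Fin N → ℝ) ⬝ᵥ ((1 - ε) • ν) = (1 - ε) * N := by
      rw [dotProduct_smul, one_dotProduct, h.sum_rate, smul_eq_mul]
    have e : ∀ a : Vec N, τ * (parallelNormSq x + freeDrift x (toReal a)) +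
        κ * (N - ∑ p, x p - ∑ p, toReal a p) =
        ((τ * (parallelNormSq x - 2 * N * ε * ∑ p, x p) + κ * (N * ε - ∑ p, x p)) +
          1 * (((2 * τ) • parallel x - κ • 1) ⬝ᵥ (toReal a - (1 - ε) • ν))) + τ * Q a := by
      intro a
      rw [freeDrift, sub_dotProduct, smul_dotProduct, smul_dotProduct, dotProduct_sub,
        dotProduct_sub, hpm, h1m, one_dotProduct]
      simp only [hQ, smul_eq_mul]
      ring
    simp_rw [e]
    rw [integral_add (hi _) (hi _), h.integral_centered, integral_const_mul,
      h.integral_arrival_quadratic]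
    ring

theorem integrable_sum (h : S.IsLoaded A ν δ ε) {π : ProbabilityMeasure (Vec N)}
    (hπ : S.IsSteadyState π) : Integrable (fun q => ∑ p, toReal q p) (π : Measure (Vec N)) := by
  refine h.integrable_of_le hπ (C := 1 + N ^ 2) fun q => ?_
  rw [abs_of_nonneg (sum_toReal_nonneg q)]
  have h1 := sq_sum_toReal_le q
  have h2 := dot_self_nonneg (toReal q)
  have h3 : ∑ p, toReal q p ≤ 1 + (∑ p, toReal q p) ^ 2 := by
    nlinarith [sq_nonneg (∑ p, toReal q p - 1), sq_nonneg (∑ p, toReal q p)]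
  have h4 : 1 + toReal q ⬝ᵥ toReal q ≤ (1 + toReal q ⬝ᵥ toReal q) ^ 2 := by nlinarith
  have h5 : (0 : ℝ) ≤ N ^ 2 := by positivity
  calc ∑ p, toReal q p ≤ 1 + N ^ 2 * (toReal q ⬝ᵥ toReal q) := by linarith
    _ ≤ (1 + N ^ 2) * (1 + toReal q ⬝ᵥ toReal q) := by nlinarith
    _ ≤ _ := mul_le_mul_of_nonneg_left h4 (by positivity)

/-- Steady-state estimate of the scaled total queue length. -/
theorem abs_scaled_total_sub_le (h : S.IsLoaded A ν δ ε) {π : ProbabilityMeasure (Vec N)}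
    (hπ : S.IsSteadyState π) {M : ℝ}
    (hM : ∫ q, perp (toReal q) ⬝ᵥ perp (toReal q) ∂(π : Measure (Vec N)) ≤ M)
    {η : ℝ} (hη : 0 < η) :
    |2 * N * ε * ∫ q, ∑ p, toReal q p ∂(π : Measure (Vec N)) -
        ((2 * N - 1) * S.totalVariance + N ^ 2 * ε ^ 2)| ≤
      (2 * N ^ 2 * (A + 1) + N ^ 3 / η) * (N * ε) + N ^ 2 * η * M := by
  set κ : ℝ := 2 * N ^ 2 * (A + 1) + N ^ 3 / η with hκ
  set V : ℝ := (2 * N - 1) * S.totalVariance + N ^ 2 * ε ^ 2 with hV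
  have hiF : Integrable (fun q => parallelNormSq (toReal q)) (π : Measure (Vec N)) := by
    refine h.integrable_of_le hπ (C := (2 * N + 1) * N ^ 2) fun q => ?_
    refine (abs_parallelNormSq_le q).trans ?_
    refine mul_le_mul_of_nonneg_left ?_ (by positivity)
    nlinarith [dot_self_nonneg (toReal q)]
  have hiT := h.integrable_sum hπ
  have hiw : Integrable (fun q => perp (toReal q) ⬝ᵥ perp (toReal q)) (π : Measure (Vec N)) := by
    refine h.integrable_of_le hπ (C := 1) fun q => ?_
    rw [abs_of_nonneg (dot_self_nonneg _)]
    nlinarith [dot_self_nonneg (toReal q), perp_dot_self_le (toReal q)]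
  have key : ∀ τ : ℝ, |τ| = 1 → 0 ≤ τ * (-(2 * N * ε * ∫ q, ∑ p, toReal q p ∂(π : Measure (Vec N)))
      + V) + (κ * (N * ε) + N ^ 2 * η * M) := by
    intro τ hτ
    have i1 : Integrable (fun q => τ * parallelNormSq (toReal q) - κ * ∑ p, toReal q p)
        (π : Measure (Vec N)) := (hiF.const_mul τ).sub (hiT.const_mul κ)
    have i2 : Integrable (fun q => τ * parallelNormSq (toReal q) - κ * ∑ p, toReal q p
        - N ^ 2 * η * (perp (toReal q) ⬝ᵥ perp (toReal q))) (π : Measure (Vec N)) :=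
      i1.sub (hiw.const_mul (N ^ 2 * η))
    have i3 : Integrable (fun q => τ * parallelNormSq (toReal q)
        - (τ * (2 * N * ε) + κ) * ∑ p, toReal q p) (π : Measure (Vec N)) :=
      (hiF.const_mul τ).sub (hiT.const_mul _)
    -- Invariance cancels `parallelNormSq` and the totals weighted by `κ`, so the lost service
    -- contributes only `κ N ε`. The signs `τ = 1` and `τ = -1` give the two sides of the absolute
    -- value.
    obtain ⟨i4, heq⟩ := integral_integral_of_invariant hπ.invariant i2
    have h1 := integral_mono i4 (i3.add (integrable_const (τ * V + κ * (N * ε)))) fun q => by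
      refine (h.integral_parallelNormSq_le hη hτ q).trans_eq ?_
      simp only [Pi.add_apply]
      rw [← hκ, ← hV]; ring
    rw [heq, integral_add' i3 (integrable_const _),
      integral_sub i1 (hiw.const_mul (N ^ 2 * η)), integral_sub (hiF.const_mul τ) (hiT.const_mul κ),
      integral_sub (hiF.const_mul τ) (hiT.const_mul _)] at h1
    simp only [integral_const_mul, integral_const, probReal_univ, one_smul] at h1
    have h2 := mul_le_mul_of_nonneg_left hM (show (0 : ℝ) ≤ N ^ 2 * η by positivity)
    linarith
  have k1 := key 1 (by simp)
  have k2 := key (-1) (by simp)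
  rw [abs_le]
  constructor <;> linarith

end IsLoaded
end MaxWeightSwitch
end InputQueued

/-! ### Passage to the heavy-traffic limit. -/

theorem corollary2 (N : ℕ) (hN : 1 ≤ N)
    -- the limiting arrival rates: positive, with all capacity constraints tight
    (ν : Fin N × Fin N → ℝ) (hν_pos : ∀ p, 0 < ν p)
    (hν_row : ∀ i, ∑ j, ν (i, j) = 1) (hν_col : ∀ j, ∑ i, ν (i, j) = 1)
    -- the switches, parametrized by `ε ∈ (0, 1)`
    (W : ℝ → InputQueued.MaxWeightSwitch N)
    (Amax : ℕ)
    (h_bdd : ∀ ε ∈ Ioo (0 : ℝ) 1,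
      ∀ᵐ a ∂((W ε).arrival : Measure (InputQueued.Vec N)), ∀ p, a p ≤ Amax)
    (h_mean : ∀ ε ∈ Ioo (0 : ℝ) 1, ∀ p,
      ∫ a, (a p : ℝ) ∂((W ε).arrival : Measure (InputQueued.Vec N)) = (1 - ε) * ν p)
    -- arrivals to different queues are independent
    (h_indep : ∀ ε ∈ Ioo (0 : ℝ) 1,
      iIndepFun (fun (p : Fin N × Fin N) (a : InputQueued.Vec N) => a p)
        ((W ε).arrival : Measure (InputQueued.Vec N)))
    -- the variances of the arrivals converge
    (σ : Fin N × Fin N → ℝ)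
    (h_var : ∀ p, Tendsto
      (fun ε => variance (fun a : InputQueued.Vec N => (a p : ℝ))
        ((W ε).arrival : Measure (InputQueued.Vec N)))
      (𝓝[>] 0) (𝓝 (σ p ^ 2))) :
    (∀ ε ∈ Ioo (0 : ℝ) 1, ∃! π, (W ε).IsSteadyState π) ∧
    ∀ π : ℝ → ProbabilityMeasure (InputQueued.Vec N),
      (∀ ε ∈ Ioo (0 : ℝ) 1, (W ε).IsSteadyState (π ε)) →
      (∀ ε ∈ Ioo (0 : ℝ) 1,
        Integrable InputQueued.totalQueue (π ε : Measure (InputQueued.Vec N))) ∧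
      Tendsto
        (fun ε => ε * ∫ q, InputQueued.totalQueue q ∂(π ε : Measure (InputQueued.Vec N)))
        (𝓝[>] 0) (𝓝 ((1 - 1 / (2 * (N : ℝ))) * ∑ p, σ p ^ 2)) := by
  have hN0 : (0 : ℝ) < N := by exact_mod_cast hN
  obtain ⟨δ, hδ, hδν⟩ : ∃ δ > 0, ∀ p, δ ≤ ν p := by
    have : Nonempty (Fin N × Fin N) := ⟨(⟨0, hN⟩, ⟨0, hN⟩)⟩
    obtain ⟨p, hp⟩ := Finite.exists_min ν
    exact ⟨ν p, hν_pos p, hp⟩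
  have hload : ∀ ε ∈ Ioo (0 : ℝ) 1, (W ε).IsLoaded Amax ν δ ε := fun ε hε =>
    ⟨h_bdd ε hε, h_mean ε hε, h_indep ε hε, hδ, hδν, hν_row, hν_col, hε.1, hε.2, hN⟩
  refine ⟨fun ε hε => (hload ε hε).existsUnique_isSteadyState, fun π hπ =>
    ⟨fun ε hε => (hload ε hε).integrable_sum (hπ ε hε), ?_⟩⟩
  obtain ⟨M, hM⟩ := InputQueued.MaxWeightSwitch.IsLoaded.exists_perp_bound N Amax hδ
  set X : ℝ → ℝ := fun ε =>
    2 * N * ε * ∫ q, InputQueued.totalQueue q ∂(π ε : Measure (InputQueued.Vec N)) with hX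
  set Y : ℝ → ℝ := fun ε => (2 * N - 1) * (W ε).totalVariance + N ^ 2 * ε ^ 2 with hY
  have hid : Tendsto (fun ε : ℝ => ε) (𝓝[>] 0) (𝓝 0) := tendsto_nhdsWithin_of_tendsto_nhds tendsto_id
  have hsqrt : Tendsto (fun ε : ℝ => √ε) (𝓝[>] 0) (𝓝 0) := by
    have := (Real.continuous_sqrt.tendsto 0).comp hid
    simpa [Function.comp_def] using this
  have hYlim : Tendsto Y (𝓝[>] 0) (𝓝 ((2 * N - 1) * ∑ p, σ p ^ 2)) := by
    have h1 : Tendsto (fun ε => (W ε).totalVariance) (𝓝[>] 0) (𝓝 (∑ p, σ p ^ 2)) :=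
      tendsto_finsetSum _ fun p _ => h_var p
    have h2 := (h1.const_mul (2 * (N : ℝ) - 1)).add ((hid.pow 2).const_mul ((N : ℝ) ^ 2))
    simpa using h2
  have hXY : Tendsto (fun ε => X ε - Y ε) (𝓝[>] 0) (𝓝 0) := by
    have hlim : Tendsto (fun ε : ℝ => 2 * N ^ 2 * (Amax + 1) * N * ε + (N ^ 4 + N ^ 2 * M) * √ε)
        (𝓝[>] 0) (𝓝 0) := by
      have := (hid.const_mul (2 * (N : ℝ) ^ 2 * (Amax + 1) * N)).add
        (hsqrt.const_mul ((N : ℝ) ^ 4 + N ^ 2 * M))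
      simpa using this
    refine squeeze_zero_norm' ?_ hlim
    have hev : Ioo (0 : ℝ) (min 1 (δ / (2 * N))) ∈ 𝓝[>] (0 : ℝ) :=
      Ioo_mem_nhdsGT (lt_min one_pos (by positivity))
    filter_upwards [hev] with ε hε
    have hε1 : ε ∈ Ioo (0 : ℝ) 1 := ⟨hε.1, hε.2.trans_le (min_le_left _ _)⟩
    have hε2 : 2 * N * ε ≤ δ := by
      have := (hε.2.trans_le (min_le_right _ _)).le
      rw [le_div_iff₀ (by positivity)] at this
      linarith
    -- Taking `η = √ε` balances the errors of order `ε / η` and `η`.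
    have h1 := (hload ε hε1).abs_scaled_total_sub_le (hπ ε hε1)
      (hM (W ε) ν ε (hload ε hε1) hε2 (π ε) (hπ ε hε1)) (Real.sqrt_pos.2 hε.1)
    refine h1.trans_eq ?_
    have h2 : √ε * √ε = ε := Real.mul_self_sqrt hε.1.le
    have h3 : (N : ℝ) ^ 3 / √ε * (N * ε) = N ^ 4 * √ε := by
      nth_rewrite 2 [← h2]
      have : √ε ≠ 0 := (Real.sqrt_pos.2 hε.1).ne'
      field_simp
    rw [add_mul, h3]
    ring
  have hfin := (hXY.add hYlim).const_mul (1 / (2 * (N : ℝ)))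
  have e1 : (fun ε => 1 / (2 * (N : ℝ)) * (X ε - Y ε + Y ε)) =
      fun ε => ε * ∫ q, InputQueued.totalQueue q ∂(π ε : Measure (InputQueued.Vec N)) := by
    funext ε
    simp only [hX]
    field_simp
    ring
  have e2 : 1 / (2 * (N : ℝ)) * (0 + (2 * N - 1) * ∑ p, σ p ^ 2) =
      (1 - 1 / (2 * (N : ℝ))) * ∑ p, σ p ^ 2 := by
    field_simp
    ring
  rwa [e1, e2] at hfin
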